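/- Let $\mathcal H_A,\mathcal H_B$ be separable complex Hilbert spaces and let $G$ be a positive semidefinite self-adjoint (in general unbounded, densely defined) operator on $\mathcal H_A$ with square root $\sqrt G$. A linear operator $V$ from $\mathcal H_A$ to a Hilbert space $\mathcal K$ with $\mathcal D(\sqrt G)\subseteq\mathcal D(V)$ is called $\sqrt G$-bounded if there are $a,b\ge 0$ with $$\|V\varphi\|^2\le a^2\|\varphi\|^2+b^2\|\sqrt G\varphi\|^2\quad\text{for all }\varphi\in\mathcal D(\sqrt G);$$ the infimum of the numbers $b\ge 0$ for which this holds with some $a\ge 0$ is the $\sqrt G$-bound of $V$, and $V$ is called $\sqrt G$-infinitesimal if it is $\sqrt G$-bounded with $\sqrt G$-bound $0$. Operators that coincide on $\mathcal D(\sqrt G)$ are identified. Let $\mathfrak T(\mathcal H)$ denote the trace class operators on $\mathcal H$, let $\mathfrak S_G(\mathcal H_A)$ be the set of states $\rho$ on $\mathcal H_A$ (positive trace class operators of trace one) with $\operatorname{Tr}G\rho<+\infty$, and let $\mathfrak T_G(\mathcal H_A)$ be its complex linear span. For $\sqrt G$-bounded operators $V_1,V_2$ from $\mathcal H_A$ to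 $\mathcal K$ and $\rho\in\mathfrak S_G(\mathcal H_A)$ put $$V_1\rho V_2^*=\sum_i|V_1\varphi_i\rangle\langle V_2\varphi_i|\in\mathfrak T(\mathcal K),$$ where $\rho=\sum_i|\varphi_i\rangle\langle\varphi_i|$ is any countable decomposition of $\rho$ into positive operators of rank one; the sum does not depend on the decomposition. If $\mathcal K=\mathcal H_B\otimes\mathcal H_E$ with $\mathcal H_E$ a separable Hilbert space, then the map $\rho\mapsto\operatorname{Tr}_E V_1\rho V_2^*$ on $\mathfrak S_G(\mathcal H_A)$, with $\operatorname{Tr}_E$ the partial trace over $\mathcal H_E$, extends uniquely to a linear map from $\mathfrak T_G(\mathcal H_A)$ into $\mathfrak T(\mathcal H_B)$, denoted in the same way. Let $\mathfrak F_G(A,B)$ (respectively $\mathfrak F_G^0(A,B)$) be the set of all linear maps $\Phi:\mathfrak T_G(\mathcal H_A)\to\mathfrak T(\mathcal H_B)$ of the form $\Phi(\rho)=\operatorname{Tr}_E V\rho V^*$ for some separable Hilbert space $\mathcal H_E$ and some $\sqrt G$-bounded (respectively $\sqrt G$-infinitesimal) operator $V$ from $\mathcal H_A$ to $\mathcal H_B\otimes\mathcal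 H_E$. Then a linear map $\Psi:\mathfrak T_G(\mathcal H_A)\to\mathfrak T(\mathcal H_B)$ belongs to the complex linear span of $\mathfrak F_G^0(A,B)$ (respectively, of $\mathfrak F_G(A,B)$) if and only if $$\Psi(\rho)=\operatorname{Tr}_E V_1\rho V_2^*,\qquad \rho\in\mathfrak T_G(\mathcal H_A),$$ for some separable Hilbert space $\mathcal H_E$ and some $\sqrt G$-infinitesimal (respectively, $\sqrt G$-bounded) operators $V_1,V_2$ from $\mathcal H_A$ to $\mathcal H_B\otimes\mathcal H_E$. -/

import Mathlib

open scoped InnerProductSpace TensorProduct ENNReal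

universe u v w

/-- A positive (semidefinite) self-adjoint, in general unbounded, operator on a Hilbert space.
Self-adjointness of a `LinearPMap` includes density of its domain. -/
structure PositiveOperator (H : Type*) [NormedAddCommGroup H] [InnerProductSpace ℂ H]
    [CompleteSpace H] where
  toLinearPMap : H →ₗ.[ℂ] H
  isSelfAdjoint : IsSelfAdjoint toLinearPMap
  nonneg : ∀ x : toLinearPMap.domain, 0 ≤ (⟪(x : H), toLinearPMap x⟫_ℂ).re

namespace PositiveOperator

variable {H : Type*} [NormedAddCommGroup H] [InnerProductSpace ℂ H] [CompleteSpace H]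

/-- `S` is a square root of `G`: the (maximally defined) composition `S ∘ S` is `G`. -/
def IsSqrt (S G : PositiveOperator H) : Prop :=
  ∀ x z : H, (x, z) ∈ G.toLinearPMap.graph ↔
    ∃ y : H, (x, y) ∈ S.toLinearPMap.graph ∧ (y, z) ∈ S.toLinearPMap.graph

theorem norm_sq_le (G : PositiveOperator H) {x y : H} (h : (x, y) ∈ G.toLinearPMap.graph) :
    ‖x‖ ^ 2 + ‖y‖ ^ 2 ≤ ‖x + y‖ ^ 2 := by
  obtain ⟨u, rfl, rfl⟩ := (LinearPMap.mem_graph_iff _).1 h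
  have := G.nonneg u
  have h2 := norm_add_sq (𝕜 := ℂ) (u : H) (G.toLinearPMap u)
  simp only [RCLike.re_to_complex] at h2
  linarith

theorem mem_graph_of_forall (G : PositiveOperator H) {u w : H}
    (h : ∀ x y : H, (x, y) ∈ G.toLinearPMap.graph → ⟪w, x⟫_ℂ = ⟪u, y⟫_ℂ) :
    (u, w) ∈ G.toLinearPMap.graph := by
  have hd := G.isSelfAdjoint.dense_domain
  have := LinearPMap.adjoint_graph_eq_graph_adjoint hd
  rw [(LinearPMap.isSelfAdjoint_def).1 G.isSelfAdjoint] at this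
  rw [this, Submodule.mem_adjoint_iff]
  intro a b hab
  have := congrArg (starRingEnd ℂ) (h a b hab)
  rw [inner_conj_symm, inner_conj_symm] at this
  simp [this]

theorem exists_resolvent (G : PositiveOperator H) :
    ∃ R : H →L[ℂ] H, ∀ y : H, (R y, y - R y) ∈ G.toLinearPMap.graph := by
  set Γ := G.toLinearPMap.graph with hΓ
  have hcl : IsClosed (Γ : Set (H × H)) := G.isSelfAdjoint.isClosed
  have : CompleteSpace Γ := hcl.completeSpace_coe
  let A : Γ →L[ℂ] H := ((ContinuousLinearMap.fst ℂ H H) + (ContinuousLinearMap.snd ℂ H H)).comp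
    Γ.subtypeL
  have hA : ∀ p : Γ, A p = p.1.1 + p.1.2 := fun p => rfl
  have hb : ∀ p : Γ, ‖p‖ ≤ ‖A p‖ := by
    intro p
    have h := norm_sq_le G p.2
    rw [← hA] at h
    change max ‖p.1.1‖ ‖p.1.2‖ ≤ _
    refine max_le ?_ ?_ <;> refine le_of_sq_le_sq ?_ (norm_nonneg _) <;> nlinarith [sq_nonneg ‖p.1.1‖, sq_nonneg ‖p.1.2‖]
  have hanti : AntilipschitzWith 1 A := A.antilipschitz_of_bound (by simpa using hb)
  have hrange : IsClosed (Set.range A) := hanti.isClosed_range A.uniformContinuous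
  have hrange' : IsClosed (A.range : Set H) := hrange
  have : CompleteSpace A.range := hrange'.completeSpace_coe
  have htop : A.range = ⊤ := by
    rw [← Submodule.orthogonal_eq_bot_iff, Submodule.eq_bot_iff]
    intro y hy
    have h1 : (y, -y) ∈ Γ := by
      refine G.mem_graph_of_forall fun a b hab => ?_
      have := (Submodule.mem_orthogonal' _ _).1 hy (A ⟨(a, b), hab⟩) ⟨_, rfl⟩
      rw [hA, inner_add_right] at this
      rw [inner_neg_left]
      linear_combination -this
    have := norm_sq_le G h1
    simp only [add_neg_cancel, norm_zero, norm_neg] at this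
    have h0 : ‖y‖ = 0 := by nlinarith [norm_nonneg y]
    simpa using h0
  let e : Γ ≃L[ℂ] H := ContinuousLinearEquiv.ofBijective A
    (LinearMap.ker_eq_bot.2 hanti.injective) htop
  refine ⟨((ContinuousLinearMap.fst ℂ H H).comp Γ.subtypeL).comp e.symm.toContinuousLinearMap, ?_⟩
  intro y
  have h1 : A (e.symm y) = y := e.apply_symm_apply y
  have h2 : y - (e.symm y).1.1 = (e.symm y).1.2 := by
    rw [sub_eq_iff_eq_add', ← hA]; exact h1.symm
  change ((e.symm y).1.1, y - (e.symm y).1.1) ∈ Γ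
  rw [h2]
  exact (e.symm y).2

theorem inner_symm (G : PositiveOperator H) {x y x' y' : H}
    (h : (x, y) ∈ G.toLinearPMap.graph) (h' : (x', y') ∈ G.toLinearPMap.graph) :
    ⟪y, x'⟫_ℂ = ⟪x, y'⟫_ℂ := by
  have hd := G.isSelfAdjoint.dense_domain
  have := LinearPMap.adjoint_graph_eq_graph_adjoint hd
  rw [(LinearPMap.isSelfAdjoint_def).1 G.isSelfAdjoint] at this
  rw [this, Submodule.mem_adjoint_iff] at h'
  exact sub_eq_zero.1 (h' x y h)

theorem inner_nonneg_of_mem_graph (G : PositiveOperator H) {x y : H}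
    (h : (x, y) ∈ G.toLinearPMap.graph) : 0 ≤ (⟪x, y⟫_ℂ).re := by
  obtain ⟨u, rfl, rfl⟩ := (LinearPMap.mem_graph_iff _).1 h
  exact G.nonneg u

/-- The partially defined operator `Q y ↦ P y`, for commuting positive `P`, `Q` with
`Q² + P² = 1` and `Q` injective with dense range. -/
theorem exists_of_pair (Q P : H →L[ℂ] H) (hQ : 0 ≤ Q) (hP : 0 ≤ P) (hc : Commute Q P)
    (hone : ∀ y, Q (Q y) + P (P y) = y) (hinj : Function.Injective Q)
    (hdense : DenseRange Q) :
    ∃ S : PositiveOperator H, ∀ x y : H,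
      (x, y) ∈ S.toLinearPMap.graph ↔ ∃ u, Q u = x ∧ P u = y := by
  have hQs := ((ContinuousLinearMap.nonneg_iff_isPositive _).1 hQ).isSymmetric
  have hPs := ((ContinuousLinearMap.nonneg_iff_isPositive _).1 hP).isSymmetric
  have hcomm : ∀ y, Q (P y) = P (Q y) := fun y => DFunLike.congr_fun hc.eq y
  let Γ : Submodule ℂ (H × H) := (Q.prod P).range
  have hΓ : ∀ x y : H, (x, y) ∈ Γ ↔ ∃ u, Q u = x ∧ P u = y := by
    intro x y
    simp [Γ, LinearMap.mem_range, Prod.ext_iff]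
  let S := Γ.toLinearPMap
  have hS : S.graph = Γ := by
    refine Submodule.toLinearPMap_graph_eq Γ ?_
    rintro ⟨x, y⟩ hxy h0
    obtain ⟨u, rfl, rfl⟩ := (hΓ _ _).1 hxy
    have : u = 0 := hinj (by simpa using h0)
    simp [this]
  have hSg : ∀ x y : H, (x, y) ∈ S.graph ↔ ∃ u, Q u = x ∧ P u = y := fun x y => by
    rw [hS]; exact hΓ x y
  have hdom : Dense (S.domain : Set H) := by
    refine hdense.mono ?_
    rintro _ ⟨u, rfl⟩
    exact LinearPMap.mem_domain_iff.2 ⟨P u, (hSg _ _).2 ⟨u, rfl, rfl⟩⟩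
  have hsa : IsSelfAdjoint S := by
    rw [LinearPMap.isSelfAdjoint_def]
    apply LinearPMap.eq_of_eq_graph
    rw [LinearPMap.adjoint_graph_eq_graph_adjoint hdom]
    ext ⟨x, z⟩
    rw [Submodule.mem_adjoint_iff, hSg]
    constructor
    · intro h
      have hPx : P x = Q z := by
        refine ext_inner_left ℂ fun u => ?_
        have h1 := sub_eq_zero.1 (h (Q u) (P u) ((hSg _ _).2 ⟨u, rfl, rfl⟩))
        exact (hPs u x).symm.trans (h1.trans (hQs u z))
      refine ⟨Q x + P z, ?_, ?_⟩
      · rw [map_add, hcomm, ← hPx, hone]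
      · rw [map_add, ← hcomm, hPx, hone]
    · rintro ⟨u, rfl, rfl⟩ a b hab
      obtain ⟨t, rfl, rfl⟩ := (hSg _ _).1 hab
      have h1 := hPs t (Q u)
      have h2 := hQs t (P u)
      simp only [ContinuousLinearMap.coe_coe] at h1 h2
      rw [h1, h2, hcomm, sub_self]
  refine ⟨⟨S, hsa, ?_⟩, hSg⟩
  intro x
  obtain ⟨u, h1, h2⟩ := (hSg _ _).1 (S.mem_graph x)
  rw [← h1, ← h2]
  have hQP := (ContinuousLinearMap.nonneg_iff_isPositive _).1 (hc.mul_nonneg hQ hP)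
  have h3 := hQP.re_inner_nonneg_right u
  have h4 := hQs u (P u)
  simp only [ContinuousLinearMap.coe_coe] at h4
  rw [h4]
  exact h3

theorem exists_isSqrt (G : PositiveOperator H) : ∃ S : PositiveOperator H, S.IsSqrt G := by
  obtain ⟨R, hR⟩ := G.exists_resolvent
  have hRsymm : ∀ y z, ⟪R y, z⟫_ℂ = ⟪y, R z⟫_ℂ := by
    intro y z
    have := G.inner_symm (hR y) (hR z)
    rw [inner_sub_left, inner_sub_right] at this
    linear_combination -this
  have hRpos : 0 ≤ R := by
    rw [ContinuousLinearMap.nonneg_iff_isPositive]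
    refine ⟨hRsymm, fun y => ?_⟩
    have h1 := G.inner_nonneg_of_mem_graph (hR y)
    have h2 := inner_self_nonneg (𝕜 := ℂ) (x := R y)
    rw [inner_sub_right, Complex.sub_re] at h1
    simp only [RCLike.re_to_complex] at h2
    change 0 ≤ (⟪R y, y⟫_ℂ).re
    linarith
  have hRpos' : 0 ≤ 1 - R := by
    rw [ContinuousLinearMap.nonneg_iff_isPositive]
    refine ⟨fun y z => ?_, fun y => ?_⟩
    · change ⟪y - R y, z⟫_ℂ = ⟪y, z - R z⟫_ℂ
      rw [inner_sub_left, inner_sub_right, hRsymm]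
    · have h1 := G.inner_nonneg_of_mem_graph (hR y)
      have h2 := inner_self_nonneg (𝕜 := ℂ) (x := y - R y)
      have h3 : ⟪y - R y, y⟫_ℂ = ⟪y - R y, y - R y⟫_ℂ + ⟪y - R y, R y⟫_ℂ := by
        rw [← inner_add_right, sub_add_cancel]
      have h4 : (⟪y - R y, R y⟫_ℂ).re = (⟪R y, y - R y⟫_ℂ).re := inner_re_symm (𝕜 := ℂ) _ _
      simp only [RCLike.re_to_complex] at h2
      change 0 ≤ (⟪y - R y, y⟫_ℂ).re
      rw [h3, Complex.add_re, h4]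
      linarith
  set Q := CFC.sqrt R with hQdef
  set P := CFC.sqrt (1 - R) with hPdef
  have hQ : 0 ≤ Q := CFC.sqrt_nonneg _
  have hP : 0 ≤ P := CFC.sqrt_nonneg _
  have hQQ : ∀ y, Q (Q y) = R y := fun y =>
    DFunLike.congr_fun (CFC.sqrt_mul_sqrt_self R hRpos) y
  have hPP : ∀ y, P (P y) = y - R y := fun y =>
    DFunLike.congr_fun (CFC.sqrt_mul_sqrt_self (1 - R) hRpos') y
  have hc : Commute Q P := by
    have h0 : Commute R (1 - R) := (Commute.one_right R).sub_right (Commute.refl R)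
    rw [hQdef, hPdef, CFC.sqrt_eq_cfc, CFC.sqrt_eq_cfc]
    exact ((h0.cfc_nnreal _).symm.cfc_nnreal _).symm
  have hRinj : Function.Injective R := by
    rw [injective_iff_map_eq_zero]
    intro y hy
    have := hR y
    rw [hy, sub_zero] at this
    exact LinearPMap.graph_fst_eq_zero_snd _ this rfl
  have hmem : ∀ {x z : H}, (x, z) ∈ G.toLinearPMap.graph → R (x + z) = x := by
    intro x z h
    have h1 := G.toLinearPMap.graph.sub_mem (hR (x + z)) h
    have h2 := G.norm_sq_le h1
    have h3 : R (x + z) - x + (x + z - R (x + z) - z) = 0 := by abel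
    simp only [h3, norm_zero] at h2
    have h4 : ‖R (x + z) - x‖ = 0 := by nlinarith [norm_nonneg (R (x + z) - x), sq_nonneg ‖x + z - R (x + z) - z‖]
    exact sub_eq_zero.1 (norm_eq_zero.1 h4)
  have hdense : DenseRange Q := by
    refine G.isSelfAdjoint.dense_domain.mono ?_
    intro x hx
    obtain ⟨z, hz⟩ := LinearPMap.mem_domain_iff.1 hx
    exact ⟨Q (x + z), by rw [hQQ, hmem hz]⟩
  have hQinj : Function.Injective Q := fun a b hab => hRinj (by rw [← hQQ, ← hQQ, hab])
  have hone : ∀ y, Q (Q y) + P (P y) = y := fun y => by rw [hQQ, hPP]; abel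
  have hcomm : ∀ y, Q (P y) = P (Q y) := fun y => DFunLike.congr_fun hc.eq y
  obtain ⟨S, hS⟩ := exists_of_pair Q P hQ hP hc hone hQinj hdense
  refine ⟨S, fun x z => ?_⟩
  simp only [hS]
  constructor
  · intro h
    refine ⟨P (Q (x + z)), ⟨Q (x + z), by rw [hQQ, hmem h], rfl⟩, P (x + z), hcomm _, ?_⟩
    rw [hPP, hmem h]; abel
  · rintro ⟨y, ⟨s, rfl, rfl⟩, t, ht, rfl⟩
    have hs : s = Q (Q s + P t) := by
      rw [map_add, hcomm, ht, hone]
    have h1 : Q s = R (Q s + P t) := by rw [← hQQ, ← hs]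
    have h2 := hR (Q s + P t)
    rwa [← h1, add_sub_cancel_left] at h2

/-- The square root `√G` of a positive self-adjoint operator `G`: the positive self-adjoint
operator whose square is `G`. -/
noncomputable def sqrt (G : PositiveOperator H) : PositiveOperator H :=
  G.exists_isSqrt.choose

theorem isSqrt_sqrt (G : PositiveOperator H) : G.sqrt.IsSqrt G :=
  G.exists_isSqrt.choose_spec

/-- The domain `D(√G)`. -/
noncomputable abbrev sqrtDomain (G : PositiveOperator H) : Submodule ℂ H :=
  G.sqrt.toLinearPMap.domain

open Classical in
/-- The quadratic form `φ ↦ ⟨φ|G|φ⟩` of `G`: it is `‖√G φ‖²` on `D(√G)` and `+∞` elsewhere. -/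
noncomputable def form (G : PositiveOperator H) (φ : H) : ℝ≥0∞ :=
  if h : φ ∈ G.sqrtDomain then ENNReal.ofReal (‖G.sqrt.toLinearPMap ⟨φ, h⟩‖ ^ 2) else ⊤

end PositiveOperator

/-- The trace class `𝔗(H)`: the bounded operators with finite trace norm
`‖T‖₁ = sup ∑ |⟨eᵢ|T fᵢ⟩|`, the supremum being over all finite orthonormal systems `e`, `f`
of the same length. -/
def traceClass (H : Type*) [NormedAddCommGroup H] [InnerProductSpace ℂ H] :
    Submodule ℂ (H →L[ℂ] H) where
  carrier := {T | ∃ C : ℝ, ∀ (n : ℕ) (e f : Fin n → H), Orthonormal ℂ e → Orthonormal ℂ f →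
    ∑ i, ‖⟪e i, T (f i)⟫_ℂ‖ ≤ C}
  zero_mem' := ⟨0, fun n e f _ _ => by simp⟩
  add_mem' := by
    rintro S T ⟨C, hC⟩ ⟨D, hD⟩
    refine ⟨C + D, fun n e f he hf => ?_⟩
    refine le_trans ?_ (add_le_add (hC n e f he hf) (hD n e f he hf))
    rw [← Finset.sum_add_distrib]
    refine Finset.sum_le_sum fun i _ => ?_
    rw [_root_.add_apply, inner_add_right]
    exact norm_add_le _ _
  smul_mem' := by
    rintro c T ⟨C, hC⟩
    refine ⟨‖c‖ * C, fun n e f he hf => ?_⟩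
    refine le_trans (le_of_eq ?_) (mul_le_mul_of_nonneg_left (hC n e f he hf) (norm_nonneg c))
    rw [Finset.mul_sum]
    refine Finset.sum_congr rfl fun i _ => ?_
    rw [_root_.smul_apply, inner_smul_right, norm_mul]

/-- `Tr T = t`: the diagonal sums of `T` converge to `t` in every orthonormal basis. -/
def HasTrace {H : Type u} [NormedAddCommGroup H] [InnerProductSpace ℂ H]
    (T : H →L[ℂ] H) (t : ℂ) : Prop :=
  ∀ (ι : Type u) (b : HilbertBasis ι ℂ H), HasSum (fun i => ⟪b i, T (b i)⟫_ℂ) t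

/-- The set `𝔖(H)` of states: positive trace class operators with unit trace. -/
def states (H : Type u) [NormedAddCommGroup H] [InnerProductSpace ℂ H] [CompleteSpace H] :
    Set (H →L[ℂ] H) :=
  {ρ | ρ ∈ traceClass H ∧ ρ.IsPositive ∧ HasTrace ρ 1}

section EnergyConstrained

variable {HA : Type u} [NormedAddCommGroup HA] [InnerProductSpace ℂ HA] [CompleteSpace HA]

/-- `Tr G ρ < ∞` for a positive operator `ρ`, where `Tr G ρ = ∑ᵢ ⟨√ρ bᵢ|G|√ρ bᵢ⟩ ∈ [0, ∞]`, which
does not depend on the orthonormal basis `b`. -/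
def HasFiniteEnergy (G : PositiveOperator HA) (ρ : HA →L[ℂ] HA) : Prop :=
  ∀ (ι : Type u) (b : HilbertBasis ι ℂ HA), ∑' i, G.form (CFC.sqrt ρ (b i)) < ⊤

/-- The set `𝔖_G(H_A)` of states with finite energy. -/
def finiteEnergyStates (G : PositiveOperator HA) : Set (HA →L[ℂ] HA) :=
  {ρ | ρ ∈ states HA ∧ HasFiniteEnergy G ρ}

/-- The linear span `𝔗_G(H_A)` of the states with finite energy. -/
def finiteEnergySpan (G : PositiveOperator HA) : Submodule ℂ (HA →L[ℂ] HA) :=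
  Submodule.span ℂ (finiteEnergyStates G)

section RelativelyBounded

variable {K : Type w} [NormedAddCommGroup K] [InnerProductSpace ℂ K]

/-- The estimate `‖V φ‖² ≤ a² ‖φ‖² + b² ‖√G φ‖²` on `D(√G)`. Operators that coincide on `D(√G)`
are identified, so an operator whose domain contains `D(√G)` is given by its restriction. -/
def RelBoundWith (G : PositiveOperator HA) (V : G.sqrtDomain →ₗ[ℂ] K) (a b : ℝ) : Prop :=
  ∀ φ : G.sqrtDomain,
    ‖V φ‖ ^ 2 ≤ a ^ 2 * ‖(φ : HA)‖ ^ 2 + b ^ 2 * ‖G.sqrt.toLinearPMap φ‖ ^ 2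

/-- `V` is `√G`-bounded. -/
def IsSqrtBounded (G : PositiveOperator HA) (V : G.sqrtDomain →ₗ[ℂ] K) : Prop :=
  ∃ a b : ℝ, 0 ≤ a ∧ 0 ≤ b ∧ RelBoundWith G V a b

/-- The `√G`-bound of `V`. -/
noncomputable def sqrtBound (G : PositiveOperator HA) (V : G.sqrtDomain →ₗ[ℂ] K) : ℝ :=
  sInf {b : ℝ | 0 ≤ b ∧ ∃ a : ℝ, 0 ≤ a ∧ RelBoundWith G V a b}

/-- `V` is `√G`-infinitesimal: it is `√G`-bounded with `√G`-bound zero. -/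
def IsSqrtInfinitesimal (G : PositiveOperator HA) (V : G.sqrtDomain →ₗ[ℂ] K) : Prop :=
  IsSqrtBounded G V ∧ sqrtBound G V = 0

/-- `T = V₁ ρ V₂*`, i.e. `T = ∑ᵢ |V₁ φᵢ⟩⟨V₂ φᵢ|` for every decomposition `ρ = ∑ᵢ |φᵢ⟩⟨φᵢ|` into
positive operators of rank at most one. (`rankOne ℂ x y` is `|x⟩⟨y|`.) -/
def IsSandwich (G : PositiveOperator HA) (V₁ V₂ : G.sqrtDomain →ₗ[ℂ] K)
    (ρ : HA →L[ℂ] HA) (T : K →L[ℂ] K) : Prop :=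
  ∀ φ : ℕ → HA, HasSum (fun i => InnerProductSpace.rankOne ℂ (φ i) (φ i)) ρ →
    ∃ h : ∀ i, φ i ∈ G.sqrtDomain,
      HasSum (fun i => InnerProductSpace.rankOne ℂ (V₁ ⟨φ i, h i⟩) (V₂ ⟨φ i, h i⟩)) T

end RelativelyBounded

/-- The Hilbert space tensor product (the completion of the algebraic one). -/
abbrev HilbertTensor (HB : Type w) (HE : Type v) [NormedAddCommGroup HB] [InnerProductSpace ℂ HB]
    [NormedAddCommGroup HE] [InnerProductSpace ℂ HE] : Type (max w v) :=
  UniformSpace.Completion (HB ⊗[ℂ] HE)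

section PartialTrace

variable {HB : Type w} [NormedAddCommGroup HB] [InnerProductSpace ℂ HB]
  {HE : Type v} [NormedAddCommGroup HE] [InnerProductSpace ℂ HE]

/-- The elementary tensor `x ⊗ y` in the Hilbert space tensor product. -/
noncomputable def elemTensor (x : HB) (y : HE) : HilbertTensor HB HE :=
  ((x ⊗ₜ[ℂ] y : HB ⊗[ℂ] HE) : UniformSpace.Completion (HB ⊗[ℂ] HE))

/-- `S = Tr_E T`, i.e. `⟨x|S y⟩ = ∑ₖ ⟨x ⊗ eₖ|T (y ⊗ eₖ)⟩` for all `x`, `y` and every orthonormal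
basis `e` of `H_E`. -/
def IsPartialTrace (T : HilbertTensor HB HE →L[ℂ] HilbertTensor HB HE) (S : HB →L[ℂ] HB) :
    Prop :=
  ∀ (ι : Type v) (e : HilbertBasis ι ℂ HE) (x y : HB),
    HasSum (fun k => ⟪elemTensor x (e k), T (elemTensor y (e k))⟫_ℂ) ⟪x, S y⟫_ℂ

/-- `Ψ(ρ) = Tr_E V₁ ρ V₂*` for all states `ρ` with finite energy, and hence by linearity on
all of `𝔗_G(H_A)`. -/
def Represents (G : PositiveOperator HA) (V₁ V₂ : G.sqrtDomain →ₗ[ℂ] HilbertTensor HB HE)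
    (Ψ : finiteEnergySpan G →ₗ[ℂ] traceClass HB) : Prop :=
  ∀ (ρ : HA →L[ℂ] HA) (hρ : ρ ∈ finiteEnergyStates G),
    ∃ T ∈ traceClass (HilbertTensor HB HE), IsSandwich G V₁ V₂ ρ T ∧
      IsPartialTrace T (Ψ ⟨ρ, Submodule.subset_span hρ⟩ : HB →L[ℂ] HB)

end PartialTrace

/-- The cone `𝔉_G(A, B)` of the linear maps `ρ ↦ Tr_E V ρ V*` from `𝔗_G(H_A)` into `𝔗(H_B)`, where
`H_E` is a separable Hilbert space and `V` is a `√G`-bounded operator from `H_A` to `H_B ⊗ H_E`. -/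
def coneFG (G : PositiveOperator HA) (HB : Type w) [NormedAddCommGroup HB]
    [InnerProductSpace ℂ HB] : Set (finiteEnergySpan G →ₗ[ℂ] traceClass HB) :=
  {Φ | ∃ (HE : Type v) (_ : NormedAddCommGroup HE) (_ : InnerProductSpace ℂ HE)
    (_ : CompleteSpace HE) (_ : TopologicalSpace.SeparableSpace HE)
    (V : G.sqrtDomain →ₗ[ℂ] HilbertTensor HB HE), IsSqrtBounded G V ∧ Represents G V V Φ}

/-- The cone `𝔉⁰_G(A, B)`, defined in the same way with `√G`-infinitesimal operators `V`. -/
def coneFG0 (G : PositiveOperator HA) (HB : Type w) [NormedAddCommGroup HB]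
    [InnerProductSpace ℂ HB] : Set (finiteEnergySpan G →ₗ[ℂ] traceClass HB) :=
  {Φ | ∃ (HE : Type v) (_ : NormedAddCommGroup HE) (_ : InnerProductSpace ℂ HE)
    (_ : CompleteSpace HE) (_ : TopologicalSpace.SeparableSpace HE)
    (V : G.sqrtDomain →ₗ[ℂ] HilbertTensor HB HE), IsSqrtInfinitesimal G V ∧ Represents G V V Φ}

end EnergyConstrained

/-!
The two nontrivial points are that `ρ ↦ Tr_E V₁ ρ V₂*` really extends to a linear map on the span
of the states of finite energy, and that it can be computed without choosing a basis of `H_E`.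

For a state `ρ` of finite energy the range of `√ρ` lies in `D(√G)`, and `(1 + √G) √ρ` is bounded by
the closed graph theorem; hence `V √ρ` is a Hilbert–Schmidt operator for every `√G`-bounded `V`.
Every decomposition `ρ = ∑ |φᵢ⟩⟨φᵢ|` is of the form `φᵢ = √ρ Z eᵢ` with a partial isometry `Z` on
`ℓ²`, which identifies `V₁ ρ V₂*` with `(V₁√ρ)(V₂√ρ)*` (`isSandwich_comp_adjoint`). Expanding in an
orthonormal basis `b` of `H_A` and slicing with `⟨x| ⊗ 1`, the relation `Ψ(ρ) = Tr_E V₁ ρ V₂*`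
becomes `⟨x|Ψ(ρ) y⟩ = ∑ⱼ ⟨(⟨y| ⊗ 1) V₂√ρ bⱼ | (⟨x| ⊗ 1) V₁√ρ bⱼ⟩` (`represents_iff`). This formula
is sesquilinear in `(V₂, V₁)` and additive over orthogonal direct sums of environments.

The linear extension exists (`exists_represents`) because `ρ = R τ R` with the injective bounded
operator `R = (1 + √G)⁻¹`, so `τ` depends linearly on `ρ`, while `V₁R` and `V₂R` are bounded.

Given this, a linear combination `∑ cₖ Tr_E Vₖ ρ Vₖ*` is `Tr_E V₁ ρ V₂*` with `V₁ = ⨁ cₖ Vₖ` and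
`V₂ = ⨁ Vₖ`, and conversely `Tr_E V₁ ρ V₂*` is a combination of the four maps given by `V₁ + c V₂`,
`c⁴ = 1`, by polarization. Bounded and infinitesimal operators are treated together, as classes of
operators closed under domination in norm (`IsBoundClass`).
-/

open ContinuousLinearMap InnerProductSpace

/-! ### Hilbert–Schmidt operators -/

section HilbertSchmidt

variable {H K L : Type*} [NormedAddCommGroup H] [InnerProductSpace ℂ H] [CompleteSpace H]
  [NormedAddCommGroup K] [InnerProductSpace ℂ K] [CompleteSpace K]
  [NormedAddCommGroup L] [InnerProductSpace ℂ L] [CompleteSpace L]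
  {ι κ : Type*}

omit [CompleteSpace H] in
theorem HilbertBasis.hasSum_norm_sq (b : HilbertBasis ι ℂ H) (x : H) :
    HasSum (fun i => ‖⟪b i, x⟫_ℂ‖ ^ 2) (‖x‖ ^ 2) := by
  have h := Complex.hasSum_re (b.hasSum_inner_mul_inner x x)
  have h2 : (⟪x, x⟫_ℂ).re = ‖x‖ ^ 2 := by
    rw [inner_self_eq_norm_sq_to_K]; norm_cast
  rw [h2] at h
  convert h using 2 with i
  rw [← inner_conj_symm x (b i), mul_comm, RCLike.mul_conj]
  norm_cast

theorem mul_le_sq_add_sq (s t : ℝ) : s * t ≤ s ^ 2 + t ^ 2 := by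
  nlinarith [sq_nonneg (s - t), sq_nonneg (s + t)]

theorem summable_mul_of_sq {f g : ι → ℝ} (hf0 : ∀ i, 0 ≤ f i) (hg0 : ∀ i, 0 ≤ g i)
    (hf : Summable fun i => f i ^ 2) (hg : Summable fun i => g i ^ 2) :
    Summable fun i => f i * g i :=
  (hf.add hg).of_nonneg_of_le (fun i => mul_nonneg (hf0 i) (hg0 i)) fun _ => mul_le_sq_add_sq _ _

omit [CompleteSpace H] [CompleteSpace K] in
/-- The matrix coefficients of a Hilbert–Schmidt operator are jointly square summable. -/
theorem summable_matrix_sq (b : HilbertBasis ι ℂ H) (f : HilbertBasis κ ℂ K) {A : H →L[ℂ] K}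
    (hA : Summable fun j => ‖A (b j)‖ ^ 2) :
    Summable fun p : ι × κ => ‖⟪f p.2, A (b p.1)⟫_ℂ‖ ^ 2 := by
  rw [summable_prod_of_nonneg (fun p => by positivity)]
  refine ⟨fun j => (f.hasSum_norm_sq (A (b j))).summable, ?_⟩
  simpa only [(f.hasSum_norm_sq _).tsum_eq] using hA

/-- The adjoint of a Hilbert–Schmidt operator is Hilbert–Schmidt. -/
theorem summable_adjoint (b : HilbertBasis ι ℂ H) (f : HilbertBasis κ ℂ K) {A : H →L[ℂ] K}
    (hA : Summable fun j => ‖A (b j)‖ ^ 2) : Summable fun k => ‖adjoint A (f k)‖ ^ 2 := by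
  have h := ((summable_prod_of_nonneg (fun p => by positivity)).1
    (summable_matrix_sq b f hA).prod_symm).2
  refine h.congr fun k => ?_
  rw [← (b.hasSum_norm_sq (adjoint A (f k))).tsum_eq]
  refine tsum_congr fun j => ?_
  rw [adjoint_inner_right, norm_inner_symm]
  rfl

/-- Hilbert–Schmidt operators form a right ideal; in particular the notion does not depend on the
orthonormal basis. -/
theorem summable_comp (b : HilbertBasis ι ℂ H) (e : HilbertBasis κ ℂ L) {A : H →L[ℂ] K}
    (hA : Summable fun j => ‖A (b j)‖ ^ 2) (Z : L →L[ℂ] H) :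
    Summable fun k => ‖A (Z (e k))‖ ^ 2 := by
  obtain ⟨w, f, -⟩ := exists_hilbertBasis ℂ K
  have h1 : Summable fun k => ‖(adjoint Z ∘L adjoint A) (f k)‖ ^ 2 := by
    refine ((summable_adjoint b f hA).mul_left (‖adjoint Z‖ ^ 2)).of_nonneg_of_le
      (fun k => by positivity) fun k => ?_
    rw [← mul_pow]
    exact pow_le_pow_left₀ (norm_nonneg _) ((adjoint Z).le_opNorm _) 2
  have h2 := summable_adjoint f e h1
  simpa [adjoint_comp] using h2

/-- The Hilbert–Schmidt inner product of `Q` and `P` may be computed in any orthonormal basis of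
either space. -/
theorem hasSum_inner_adjoint (b : HilbertBasis ι ℂ H) (f : HilbertBasis κ ℂ K)
    {P Q : H →L[ℂ] K} (hP : Summable fun j => ‖P (b j)‖ ^ 2)
    (hQ : Summable fun j => ‖Q (b j)‖ ^ 2) {t : ℂ}
    (ht : HasSum (fun j => ⟪Q (b j), P (b j)⟫_ℂ) t) :
    HasSum (fun k => ⟪adjoint P (f k), adjoint Q (f k)⟫_ℂ) t := by
  have hs : Summable fun p : ι × κ => ⟪Q (b p.1), f p.2⟫_ℂ * ⟪f p.2, P (b p.1)⟫_ℂ := by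
    refine Summable.of_norm_bounded
      ((summable_matrix_sq b f hQ).add (summable_matrix_sq b f hP)) fun p => ?_
    rw [norm_mul, norm_inner_symm]
    exact mul_le_sq_add_sq _ _
  have h1 : HasSum (fun p : ι × κ => ⟪Q (b p.1), f p.2⟫_ℂ * ⟪f p.2, P (b p.1)⟫_ℂ) t := by
    obtain ⟨s, hs⟩ := hs
    rwa [← (hs.prod_fiberwise fun j => f.hasSum_inner_mul_inner (Q (b j)) (P (b j))).unique ht]
  have h2 := (Equiv.prodComm κ ι).hasSum_iff.2 h1
  refine h2.prod_fiberwise fun k => ?_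
  have h3 := b.hasSum_inner_mul_inner (adjoint P (f k)) (adjoint Q (f k))
  simp only [adjoint_inner_left P, adjoint_inner_right Q] at h3
  simpa [adjoint_inner_left, mul_comm] using h3

/-- The factorisation `A B*` expands along an orthonormal basis as `∑ |A eᵢ⟩⟨B eᵢ|`, the series
being absolutely convergent in operator norm. -/
theorem hasSum_rankOne (b : HilbertBasis ι ℂ H) {A B : H →L[ℂ] K}
    (hA : Summable fun j => ‖A (b j)‖ ^ 2) (hB : Summable fun j => ‖B (b j)‖ ^ 2) :
    HasSum (fun j => rankOne ℂ (A (b j)) (B (b j))) (A ∘L adjoint B) := by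
  have hs : Summable fun j => rankOne ℂ (A (b j)) (B (b j)) := by
    refine Summable.of_norm ?_
    simp only [norm_rankOne]
    exact summable_mul_of_sq (fun _ => norm_nonneg _) (fun _ => norm_nonneg _) hA hB
  obtain ⟨T, hT⟩ := hs
  convert hT
  ext y
  refine ext_inner_left ℂ fun x => ?_
  have h1 : HasSum (fun j => ⟪x, rankOne ℂ (A (b j)) (B (b j)) y⟫_ℂ) ⟪x, T y⟫_ℂ :=
    hT.mapL ((innerSL ℂ x) ∘L (ContinuousLinearMap.apply ℂ K y))
  refine HasSum.unique ?_ h1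
  have h2 := b.hasSum_inner_mul_inner (adjoint A x) (adjoint B y)
  rw [adjoint_inner_left A] at h2
  simpa [inner_smul_right, adjoint_inner_left, adjoint_inner_right, mul_comm] using h2

theorem sum_norm_adjoint_sq_le (b : HilbertBasis ι ℂ H) {A : H →L[ℂ] K}
    (hA : Summable fun j => ‖A (b j)‖ ^ 2) {n : ℕ} {e : Fin n → K} (he : Orthonormal ℂ e) :
    ∑ i, ‖adjoint A (e i)‖ ^ 2 ≤ ∑' j, ‖A (b j)‖ ^ 2 := by
  have h := hasSum_sum (s := Finset.univ) fun i _ => b.hasSum_norm_sq (adjoint A (e i))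
  rw [← h.tsum_eq]
  refine h.summable.tsum_le_tsum (fun j => ?_) hA
  refine le_trans (le_of_eq ?_) (he.sum_inner_products_le (x := A (b j)) (s := Finset.univ))
  refine Finset.sum_congr rfl fun i _ => ?_
  rw [adjoint_inner_right, norm_inner_symm]

/-- A product of two Hilbert–Schmidt operators is of trace class. -/
theorem comp_adjoint_mem_traceClass (b : HilbertBasis ι ℂ H) {A B : H →L[ℂ] K}
    (hA : Summable fun j => ‖A (b j)‖ ^ 2) (hB : Summable fun j => ‖B (b j)‖ ^ 2) :
    A ∘L adjoint B ∈ traceClass K := by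
  refine ⟨∑' j, ‖A (b j)‖ ^ 2 + ∑' j, ‖B (b j)‖ ^ 2, fun n e f he hf => ?_⟩
  refine le_trans ?_ (add_le_add (sum_norm_adjoint_sq_le b hA he) (sum_norm_adjoint_sq_le b hB hf))
  rw [← Finset.sum_add_distrib]
  refine Finset.sum_le_sum fun i _ => ?_
  rw [comp_apply, ← adjoint_inner_left]
  exact (norm_inner_le_norm _ _).trans (mul_le_sq_add_sq _ _)

/-- If `s² = ∑ |φᵢ⟩⟨φᵢ|` with `s` self-adjoint, then `φᵢ = s (Z eᵢ)` for the standard basis `e` of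
`ℓ²` and a partial isometry `Z` onto the closure of the range of `s`. -/
theorem exists_partialIsometry_of_hasSum {s : H →L[ℂ] H} (hs : adjoint s = s) {φ : ℕ → H}
    (hφ : HasSum (fun i => rankOne ℂ (φ i) (φ i)) (s ∘L s)) :
    ∃ (e : HilbertBasis ℕ ℂ (lp (fun _ : ℕ => ℂ) 2)) (Z : lp (fun _ : ℕ => ℂ) 2 →L[ℂ] H),
      (∀ i, s (Z (e i)) = φ i) ∧ s ∘L Z ∘L adjoint Z = s := by
  have hsum : ∀ x, HasSum (fun i => ‖⟪φ i, x⟫_ℂ‖ ^ 2) (‖s x‖ ^ 2) := by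
    intro x
    have h1 : HasSum (fun j => ⟪x, rankOne ℂ (φ j) (φ j) x⟫_ℂ) ⟪x, s (s x)⟫_ℂ :=
      hφ.mapL ((innerSL ℂ x) ∘L (ContinuousLinearMap.apply ℂ H x))
    have h2 : ⟪x, s (s x)⟫_ℂ = ((‖s x‖ ^ 2 : ℝ) : ℂ) := by
      rw [← adjoint_inner_left, hs, inner_self_eq_norm_sq_to_K]; norm_cast
    rw [h2] at h1
    refine Complex.hasSum_ofReal.1 ?_
    convert h1 using 2 with i
    rw [rankOne_apply, inner_smul_right, ← inner_conj_symm x, RCLike.mul_conj]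
    norm_cast
  -- the analysis operator `x ↦ (⟪φ i, x⟫)ᵢ`
  let C : H →ₗ[ℂ] lp (fun _ : ℕ => ℂ) 2 :=
    { toFun := fun x => ⟨fun i => ⟪φ i, x⟫_ℂ, memℓp_gen (by simpa using (hsum x).summable)⟩
      map_add' := fun x y => by ext i; exact inner_add_right _ _ _
      map_smul' := fun c x => by ext i; exact inner_smul_right _ _ _ }
  have hC : ∀ x i, C x i = ⟪φ i, x⟫_ℂ := fun x i => rfl
  have hCn : ∀ x, ‖C x‖ = ‖s x‖ := by
    intro x
    have h := lp.norm_rpow_eq_tsum (p := 2) (by norm_num) (C x)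
    simp only [ENNReal.toReal_ofNat, Real.rpow_two, hC, (hsum x).tsum_eq] at h
    exact (sq_eq_sq₀ (norm_nonneg _) (norm_nonneg _)).1 h
  let M : Submodule ℂ H := s.range.topologicalClosure
  have : CompleteSpace M := s.range.isClosed_topologicalClosure.completeSpace_coe
  let r : H →L[ℂ] M := s.codRestrict M fun x => s.range.le_topologicalClosure ⟨x, rfl⟩
  have hr : ∀ x, (r x : H) = s x := fun x => rfl
  have hrn : ∀ x, ‖r x‖ = ‖s x‖ := fun x => rfl
  have hrd : DenseRange r := by
    intro m
    rw [closure_subtype]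
    have := m.2
    rw [← SetLike.mem_coe, Submodule.topologicalClosure_coe] at this
    convert this
    ext y
    simp [hr]
  let W : M →L[ℂ] lp (fun _ : ℕ => ℂ) 2 := C.extendOfNorm r.toLinearMap
  have hW : ∀ x, W (r x) = C x := fun x =>
    LinearMap.extendOfNorm_eq (f := C) (e := r.toLinearMap) hrd
      ⟨1, fun x => by simp [hCn, hrn]⟩ x
  have hWn : ∀ m, ‖W m‖ = ‖m‖ := by
    intro m
    refine hrd.induction_on (p := fun m => ‖W m‖ = ‖m‖) m
      (isClosed_eq (by fun_prop) (by fun_prop)) fun x => ?_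
    rw [hW, hCn, hrn]
  have hWW : adjoint W ∘L W = 1 := (norm_map_iff_adjoint_comp_self W).1 hWn
  let e : HilbertBasis ℕ ℂ (lp (fun _ : ℕ => ℂ) 2) := HilbertBasis.ofRepr (.refl _ _)
  have he : ∀ i g, ⟪e i, g⟫_ℂ = g i := fun i g => (e.repr_apply_apply g i).symm
  refine ⟨e, M.subtypeL ∘L adjoint W, fun i => ?_, ?_⟩
  · refine ext_inner_right ℂ fun x => ?_
    rw [← hC, ← he, ← hW, ← adjoint_inner_left W, ← adjoint_inner_right s, hs]
    rfl
  · ext x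
    refine ext_inner_left ℂ fun y => ?_
    have h1 : ∀ z, adjoint W (W z) = z := fun z => DFunLike.congr_fun hWW z
    simp only [comp_apply, adjoint_comp, adjoint_adjoint, h1]
    rw [← adjoint_inner_left s, ← adjoint_inner_left s, hs, ← hr]
    exact adjoint_inner_right M.subtypeL (r y) x

end HilbertSchmidt

/-! ### Slices of the Hilbert space tensor product -/

section Slices

variable {HB : Type w} [NormedAddCommGroup HB] [InnerProductSpace ℂ HB]
  {HE : Type v} [NormedAddCommGroup HE] [InnerProductSpace ℂ HE]

/-- The bounded bilinear map `(x, y) ↦ x ⊗ y` into the Hilbert space tensor product. -/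
noncomputable def elemTensorL : HB →L[ℂ] HE →L[ℂ] HilbertTensor HB HE :=
  (compL ℂ HE (HB ⊗[ℂ] HE) (HilbertTensor HB HE) UniformSpace.Completion.toComplL) ∘L
    TensorProduct.mkL ℂ HB HE

@[simp] theorem elemTensorL_apply (x : HB) (y : HE) : elemTensorL x y = elemTensor x y := rfl

theorem inner_elemTensor (x x' : HB) (y y' : HE) :
    ⟪elemTensor x y, elemTensor x' y'⟫_ℂ = ⟪x, x'⟫_ℂ * ⟪y, y'⟫_ℂ := by
  simp [elemTensor]

theorem norm_elemTensor (x : HB) (y : HE) : ‖elemTensor x y‖ = ‖x‖ * ‖y‖ := by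
  simp [elemTensor]

theorem norm_elemTensorL_le (x : HB) :
    ‖(elemTensorL x : HE →L[ℂ] HilbertTensor HB HE)‖ ≤ ‖x‖ :=
  opNorm_le_bound _ (norm_nonneg _) fun y => by rw [elemTensorL_apply, norm_elemTensor]

theorem norm_flip_elemTensorL_le (y : HE) :
    ‖((elemTensorL (HB := HB)).flip y : HB →L[ℂ] HilbertTensor HB HE)‖ ≤ ‖y‖ :=
  opNorm_le_bound _ (norm_nonneg _) fun x => by
    rw [flip_apply, elemTensorL_apply, norm_elemTensor, mul_comm]

/-- Two bounded operators on the Hilbert space tensor product agree once they agree on elementary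
tensors. -/
theorem HilbertTensor.ext_elemTensor {F : Type*} [NormedAddCommGroup F] [NormedSpace ℂ F]
    {S T : HilbertTensor HB HE →L[ℂ] F}
    (h : ∀ x y, S (elemTensor x y) = T (elemTensor x y)) : S = T := by
  ext u
  refine UniformSpace.Completion.induction_on u (isClosed_eq (by fun_prop) (by fun_prop))
    fun t => ?_
  induction t using TensorProduct.induction_on with
  | zero => rw [UniformSpace.Completion.coe_zero, map_zero, map_zero]
  | tmul x y => exact h x y
  | add s t hs ht => rw [UniformSpace.Completion.coe_add, map_add, map_add, hs, ht]

variable [CompleteSpace HE]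

/-- The slice `u ↦ (⟨x| ⊗ 1) u` from `H_B ⊗ H_E` to `H_E`. -/
noncomputable def slice (x : HB) : HilbertTensor HB HE →L[ℂ] HE := adjoint (elemTensorL x)

theorem inner_slice (x : HB) (y : HE) (u : HilbertTensor HB HE) :
    ⟪y, slice x u⟫_ℂ = ⟪elemTensor x y, u⟫_ℂ :=
  adjoint_inner_right _ _ _

theorem norm_slice_le (x : HB) (u : HilbertTensor HB HE) : ‖slice x u‖ ≤ ‖x‖ * ‖u‖ := by
  refine (le_opNorm _ _).trans (mul_le_mul_of_nonneg_right ?_ (norm_nonneg _))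
  rw [slice, LinearIsometryEquiv.norm_map]
  exact norm_elemTensorL_le x

@[simp] theorem slice_elemTensor (x x' : HB) (y : HE) :
    slice x (elemTensor x' y) = ⟪x, x'⟫_ℂ • y :=
  ext_inner_left ℂ fun z => by rw [inner_slice, inner_elemTensor, inner_smul_right]

theorem slice_add (x x' : HB) (u : HilbertTensor HB HE) :
    slice (x + x') u = slice x u + slice x' u := by
  simp [slice]

theorem slice_smul (c : ℂ) (x : HB) (u : HilbertTensor HB HE) :
    slice (c • x) u = (starRingEnd ℂ) c • slice x u := by
  simp [slice, map_smulₛₗ]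

/-- Bessel's inequality for slices. -/
theorem sum_norm_slice_sq_le {n : ℕ} {x : Fin n → HB} (hx : Orthonormal ℂ x)
    (u : HilbertTensor HB HE) : ∑ i, ‖slice (x i) u‖ ^ 2 ≤ ‖u‖ ^ 2 := by
  -- the projection of `u` onto the span of the `x i ⊗ H_E`
  set p := ∑ i, elemTensor (x i) (slice (x i) u) with hp
  have h1 : ∀ z, ⟪p, z⟫_ℂ = ∑ i, ⟪slice (x i) u, slice (x i) z⟫_ℂ := fun z => by
    rw [hp, sum_inner]
    exact Finset.sum_congr rfl fun i _ => (inner_slice _ _ _).symm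
  have h2 : ∀ i, slice (x i) p = slice (x i) u := by
    intro i
    rw [hp, map_sum, Finset.sum_eq_single i]
    · rw [slice_elemTensor, orthonormal_iff_ite.1 hx i i, if_pos rfl, one_smul]
    · intro k _ hk
      rw [slice_elemTensor, orthonormal_iff_ite.1 hx i k, if_neg (Ne.symm hk), zero_smul]
    · simp
  have h3 : ⟪p, p⟫_ℂ = ⟪p, u⟫_ℂ := by simp only [h1, h2]
  have h4 : ‖p‖ ^ 2 = ∑ i, ‖slice (x i) u‖ ^ 2 := by
    have h := h1 p
    simp only [h2, inner_self_eq_norm_sq_to_K] at h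
    exact_mod_cast h
  have h5 : ‖p‖ ^ 2 ≤ ‖p‖ * ‖u‖ := by
    have h := norm_inner_le_norm (𝕜 := ℂ) p u
    rw [← h3, inner_self_eq_norm_sq_to_K] at h
    simpa using h
  rw [← h4]
  have := norm_nonneg p
  nlinarith [sq_nonneg (‖p‖ - ‖u‖)]

/-- An isometry `H_E → L` induces a bounded operator `H_B ⊗ H_E → H_B ⊗ L` compatible with
slices. -/
theorem exists_lTensor {L : Type*} [NormedAddCommGroup L] [InnerProductSpace ℂ L] [CompleteSpace L]
    (j : HE →ₗᵢ[ℂ] L) :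
    ∃ I : HilbertTensor HB HE →L[ℂ] HilbertTensor HB L, ∀ x u, slice x (I u) = j (slice x u) := by
  let f : HB ⊗[ℂ] HE →L[ℂ] HilbertTensor HB L :=
    UniformSpace.Completion.toComplL ∘L j.toContinuousLinearMap.lTensor HB
  let I : HilbertTensor HB HE →L[ℂ] HilbertTensor HB L :=
    f.extend (UniformSpace.Completion.toComplL)
  have hI : ∀ x y, I (elemTensor x y) = elemTensor x (j y) := fun x y =>
    f.extend_eq UniformSpace.Completion.denseRange_coe
      (UniformSpace.Completion.isUniformInducing_coe _) (x ⊗ₜ[ℂ] y)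
  refine ⟨I, fun x u => ?_⟩
  have h : slice x ∘L I = j.toContinuousLinearMap ∘L slice x :=
    HilbertTensor.ext_elemTensor fun x' y => by simp [hI]
  exact DFunLike.congr_fun h u

end Slices

/-! ### Partial traces -/

section PartialTraceFormula

variable {HB : Type w} [NormedAddCommGroup HB] [InnerProductSpace ℂ HB] [CompleteSpace HB]
  {HE : Type v} [NormedAddCommGroup HE] [InnerProductSpace ℂ HE] [CompleteSpace HE]

/-- The partial trace of the rank one operator `|u⟩⟨v|`. -/
theorem exists_partialTrace_rankOne (u v : HilbertTensor HB HE) :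
    ∃ S : HB →L[ℂ] HB, ‖S‖ ≤ ‖u‖ * ‖v‖ ∧ ∀ x y, ⟪x, S y⟫_ℂ = ⟪slice y v, slice x u⟫_ℂ := by
  let S : HB →ₗ[ℂ] HB :=
    { toFun := fun y => adjoint (elemTensorL.flip (slice y v)) u
      map_add' := fun y z => by simp [slice_add]
      map_smul' := fun c y => by simp [slice_smul, map_smulₛₗ] }
  refine ⟨S.mkContinuous (‖u‖ * ‖v‖) fun y => ?_, ?_, fun x y => ?_⟩
  · refine ((adjoint (elemTensorL.flip (slice y v))).le_opNorm u).trans ?_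
    rw [LinearIsometryEquiv.norm_map]
    have h1 := norm_flip_elemTensorL_le (HB := HB) (slice y v)
    have h2 := norm_slice_le y v
    calc _ ≤ (‖y‖ * ‖v‖) * ‖u‖ := by gcongr; exact h1.trans h2
      _ = _ := by ring
  · exact S.mkContinuous_norm_le (by positivity) _
  · change ⟪x, adjoint (elemTensorL.flip (slice y v)) u⟫_ℂ = _
    rw [adjoint_inner_right, inner_slice]
    rfl

variable {H : Type*} [NormedAddCommGroup H] [InnerProductSpace ℂ H] [CompleteSpace H]
  {ι : Type*} (b : HilbertBasis ι ℂ H) {A B : H →L[ℂ] HilbertTensor HB HE}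

omit [CompleteSpace HB] in
theorem summable_slice {α : Type*} {a : α → HilbertTensor HB HE} (ha : Summable fun j => ‖a j‖ ^ 2)
    (x : HB) : Summable fun j => ‖slice x (a j)‖ ^ 2 := by
  refine (ha.mul_left (‖x‖ ^ 2)).of_nonneg_of_le (fun _ => by positivity) fun j => ?_
  rw [← mul_pow]
  exact pow_le_pow_left₀ (norm_nonneg _) (norm_slice_le _ _) 2

/-- The partial trace of `∑ |uⱼ⟩⟨vⱼ|` exists as a trace class operator. -/
theorem exists_partialTrace {u v : ι → HilbertTensor HB HE}
    (hu : Summable fun j => ‖u j‖ ^ 2) (hv : Summable fun j => ‖v j‖ ^ 2) :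
    ∃ S ∈ traceClass HB, ∀ x y, HasSum (fun j => ⟪slice y (v j), slice x (u j)⟫_ℂ) ⟪x, S y⟫_ℂ := by
  choose s hs1 hs2 using fun j => exists_partialTrace_rankOne (u j) (v j)
  have hs : Summable s := Summable.of_norm_bounded
    (summable_mul_of_sq (fun _ => norm_nonneg _) (fun _ => norm_nonneg _) hu hv) hs1
  obtain ⟨S, hS⟩ := hs
  have hin : ∀ x y, HasSum (fun j => ⟪slice y (v j), slice x (u j)⟫_ℂ) ⟪x, S y⟫_ℂ := by
    intro x y
    simp only [← hs2]
    exact hS.mapL ((innerSL ℂ x) ∘L (ContinuousLinearMap.apply ℂ HB y))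
  refine ⟨S, ⟨∑' j, (‖v j‖ ^ 2 + ‖u j‖ ^ 2), fun n e f he hf => ?_⟩, hin⟩
  have h1 : ∀ i, Summable fun j => ‖slice (f i) (v j)‖ ^ 2 + ‖slice (e i) (u j)‖ ^ 2 := fun i =>
    (summable_slice hv _).add (summable_slice hu _)
  calc ∑ i, ‖⟪e i, S (f i)⟫_ℂ‖
      ≤ ∑ i, ∑' j, (‖slice (f i) (v j)‖ ^ 2 + ‖slice (e i) (u j)‖ ^ 2) := by
        refine Finset.sum_le_sum fun i _ => ?_
        rw [← (hin (e i) (f i)).tsum_eq]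
        exact tsum_of_norm_bounded (h1 i).hasSum fun j =>
          (norm_inner_le_norm _ _).trans (mul_le_sq_add_sq _ _)
    _ = ∑' j, ∑ i, (‖slice (f i) (v j)‖ ^ 2 + ‖slice (e i) (u j)‖ ^ 2) :=
        (Summable.tsum_finsetSum fun i _ => h1 i).symm
    _ ≤ ∑' j, (‖v j‖ ^ 2 + ‖u j‖ ^ 2) := by
        refine (summable_sum fun i _ => h1 i).tsum_le_tsum (fun j => ?_) (hv.add hu)
        rw [Finset.sum_add_distrib]
        exact add_le_add (sum_norm_slice_sq_le hf _) (sum_norm_slice_sq_le he _)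

/-- A formula for the partial trace of `A B*` that involves no basis of `H_E`. -/
theorem isPartialTrace_comp_adjoint_iff (hA : Summable fun j => ‖A (b j)‖ ^ 2)
    (hB : Summable fun j => ‖B (b j)‖ ^ 2) (S : HB →L[ℂ] HB) :
    IsPartialTrace (A ∘L adjoint B) S ↔
      ∀ x y, HasSum (fun j => ⟪slice y (B (b j)), slice x (A (b j))⟫_ℂ) ⟪x, S y⟫_ℂ := by
  have key : ∀ (κ : Type v) (e : HilbertBasis κ ℂ HE) (x y : HB) (t : ℂ),
      HasSum (fun j => ⟪slice y (B (b j)), slice x (A (b j))⟫_ℂ) t →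
      HasSum (fun k => ⟪elemTensor x (e k), (A ∘L adjoint B) (elemTensor y (e k))⟫_ℂ) t := by
    intro κ e x y t ht
    have h := hasSum_inner_adjoint b e (P := slice x ∘L A) (Q := slice y ∘L B)
      (summable_slice hA x) (summable_slice hB y) ht
    simpa only [slice, adjoint_comp, adjoint_adjoint, comp_apply, elemTensorL_apply,
      adjoint_inner_left] using h
  refine ⟨fun h x y => ?_, fun h κ e x y => key κ e x y _ (h x y)⟩
  obtain ⟨S', -, hS'⟩ := exists_partialTrace hA hB
  obtain ⟨κ, e, -⟩ := exists_hilbertBasis ℂ HE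
  rw [(h κ e x y).unique (key κ e x y _ (hS' x y))]
  exact hS' x y

end PartialTraceFormula

/-! ### States of finite energy -/

section Energy

variable {H : Type u} [NormedAddCommGroup H] [InnerProductSpace ℂ H] [CompleteSpace H]

/-- The resolvent `R = (1 + S)⁻¹` of a positive operator `S` is a bounded injective self-adjoint
operator with range `D(S)`. -/
theorem PositiveOperator.exists_resolvent_properties (S : PositiveOperator H) :
    ∃ R : H →L[ℂ] H, adjoint R = R ∧ Function.Injective R ∧
      (∀ y, ∃ h : R y ∈ S.toLinearPMap.domain, S.toLinearPMap ⟨R y, h⟩ = y - R y) ∧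
      ∀ x : S.toLinearPMap.domain, R (x + S.toLinearPMap x) = x := by
  obtain ⟨R, hR⟩ := S.exists_resolvent
  refine ⟨R, ?_, ?_, fun y => ?_, fun x => ?_⟩
  · refine ((eq_adjoint_iff R R).2 fun y z => ?_).symm
    have := S.inner_symm (hR y) (hR z)
    rw [inner_sub_left, inner_sub_right] at this
    linear_combination -this
  · rw [injective_iff_map_eq_zero]
    intro y hy
    have := hR y
    rw [hy, sub_zero] at this
    exact LinearPMap.graph_fst_eq_zero_snd _ this rfl
  · obtain ⟨z, hz1, hz2⟩ := (LinearPMap.mem_graph_iff _).1 (hR y)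
    change (z : H) = R y at hz1
    change S.toLinearPMap z = y - R y at hz2
    refine ⟨hz1 ▸ z.2, ?_⟩
    rw [← hz2]
    exact congrArg _ (Subtype.ext hz1.symm)
  · set y := S.toLinearPMap x with hy
    have h1 := S.toLinearPMap.graph.sub_mem (hR (x + y)) (S.toLinearPMap.mem_graph x)
    have h2 := S.norm_sq_le h1
    rw [← hy] at h2
    have h3 : R (x + y) - x + (x + y - R (x + y) - y) = 0 := by abel
    simp only [h3, norm_zero] at h2
    have h4 : ‖R (x + y) - x‖ = 0 := by
      nlinarith [norm_nonneg (R (x + y) - x), sq_nonneg ‖x + y - R (x + y) - y‖]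
    exact sub_eq_zero.1 (norm_eq_zero.1 h4)

variable {G : PositiveOperator H} {ρ : H →L[ℂ] H}

theorem nonneg_of_mem_finiteEnergyStates (hρ : ρ ∈ finiteEnergyStates G) : 0 ≤ ρ :=
  (nonneg_iff_isPositive ρ).2 hρ.1.2.1

theorem adjoint_sqrt (ρ : H →L[ℂ] H) : adjoint (CFC.sqrt ρ) = CFC.sqrt ρ :=
  ((nonneg_iff_isPositive _).1 (CFC.sqrt_nonneg ρ)).isSelfAdjoint.adjoint_eq

theorem sqrt_comp_sqrt (hρ : ρ ∈ finiteEnergyStates G) : CFC.sqrt ρ ∘L CFC.sqrt ρ = ρ :=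
  CFC.sqrt_mul_sqrt_self ρ (nonneg_of_mem_finiteEnergyStates hρ)

/-- Finite energy forces the whole range of `√ρ` into `D(√G)`, because each unit vector belongs to
some orthonormal basis. -/
theorem sqrt_apply_mem_sqrtDomain (hρ : ρ ∈ finiteEnergyStates G) (x : H) :
    CFC.sqrt ρ x ∈ G.sqrtDomain := by
  by_cases hx : x = 0
  · simp [hx]
  have hn : ‖x‖ ≠ 0 := norm_ne_zero_iff.2 hx
  have hu : Orthonormal ℂ ((↑) : ({((‖x‖ : ℂ)⁻¹) • x} : Set H) → H) := by
    refine ⟨?_, fun i j hij => absurd (Subsingleton.elim i j) hij⟩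
    rintro ⟨_, rfl⟩
    simp [norm_smul, hn]
  obtain ⟨w, b, hw, hb⟩ := hu.exists_hilbertBasis_extension
  have h1 := ENNReal.ne_top_of_tsum_ne_top (hρ.2 w b).ne ⟨_, hw rfl⟩
  rw [hb] at h1
  have h2 : CFC.sqrt ρ ((‖x‖ : ℂ)⁻¹ • x) ∈ G.sqrtDomain := by
    by_contra hc
    exact h1 (by simp only [PositiveOperator.form]; rw [dif_neg hc])
  have h3 := G.sqrtDomain.smul_mem (‖x‖ : ℂ) h2
  rwa [← map_smul, smul_smul, mul_inv_cancel₀ (by exact_mod_cast hn), one_smul] at h3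

/-- `√ρ x` as an element of `D(√G)`. -/
noncomputable def sqrtVec (hρ : ρ ∈ finiteEnergyStates G) (x : H) : G.sqrtDomain :=
  ⟨CFC.sqrt ρ x, sqrt_apply_mem_sqrtDomain hρ x⟩

theorem summable_sqrt {ι : Type u} (b : HilbertBasis ι ℂ H) (hρ : ρ ∈ finiteEnergyStates G) :
    Summable fun j => ‖CFC.sqrt ρ (b j)‖ ^ 2 := by
  refine (Complex.hasSum_re (hρ.1.2.2 ι b)).summable.congr fun j => ?_
  have h : ⟪b j, ρ (b j)⟫_ℂ = ((‖CFC.sqrt ρ (b j)‖ ^ 2 : ℝ) : ℂ) := by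
    conv_lhs => rw [← sqrt_comp_sqrt hρ]
    rw [comp_apply, ← adjoint_inner_left, adjoint_sqrt, inner_self_eq_norm_sq_to_K]
    norm_cast
  rw [h, Complex.ofReal_re]

theorem summable_energy {ι : Type u} (b : HilbertBasis ι ℂ H) (hρ : ρ ∈ finiteEnergyStates G) :
    Summable fun j => ‖G.sqrt.toLinearPMap (sqrtVec hρ (b j))‖ ^ 2 := by
  have h := hρ.2 ι b
  have h2 : ∀ j, G.form (CFC.sqrt ρ (b j)) =
      ENNReal.ofReal (‖G.sqrt.toLinearPMap (sqrtVec hρ (b j))‖ ^ 2) := fun j =>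
    dif_pos (sqrt_apply_mem_sqrtDomain hρ (b j))
  simp only [h2] at h
  refine (ENNReal.summable_toReal h.ne).congr fun j => ?_
  rw [ENNReal.toReal_ofReal (by positivity)]

/-- `√ρ` factors through the resolvent of `√G` by the bounded operator `(1 + √G) √ρ`; boundedness
is the closed graph theorem. -/
theorem exists_resolvent_factor {R : H →L[ℂ] H} (hinj : Function.Injective R)
    (hR : ∀ x : G.sqrtDomain, R (x + G.sqrt.toLinearPMap x) = x)
    (hρ : ρ ∈ finiteEnergyStates G) : ∃ D : H →L[ℂ] H, R ∘L D = CFC.sqrt ρ := by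
  let D : H →ₗ[ℂ] H :=
    { toFun := fun x => CFC.sqrt ρ x + G.sqrt.toLinearPMap (sqrtVec hρ x)
      map_add' := fun x y => by
        have : sqrtVec hρ (x + y) = sqrtVec hρ x + sqrtVec hρ y := Subtype.ext (map_add _ _ _)
        rw [this, map_add, LinearPMap.map_add]; abel
      map_smul' := fun c x => by
        have : sqrtVec hρ (c • x) = c • sqrtVec hρ x := Subtype.ext (map_smul _ _ _)
        rw [this, map_smul, LinearPMap.map_smul, RingHom.id_apply, smul_add] }
  have hD : ∀ x, R (D x) = CFC.sqrt ρ x := fun x => hR (sqrtVec hρ x)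
  have hcont : Continuous D := by
    refine D.continuous_of_seq_closed_graph fun x a c hx hc => hinj ?_
    have h1 := (R.continuous.tendsto c).comp hc
    have h2 := ((CFC.sqrt ρ).continuous.tendsto a).comp hx
    rw [hD]
    refine tendsto_nhds_unique h1 (h2.congr fun n => (hD (x n)).symm)
  exact ⟨⟨D, hcont⟩, ContinuousLinearMap.ext hD⟩

theorem exists_rankOne_decomposition (hρ : ρ ∈ finiteEnergyStates G) :
    ∃ φ : ℕ → H, HasSum (fun i => rankOne ℂ (φ i) (φ i)) ρ := by
  obtain ⟨w, b, -⟩ := exists_hilbertBasis ℂ H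
  have h := hasSum_rankOne b (summable_sqrt b hρ) (summable_sqrt b hρ)
  rw [adjoint_sqrt, sqrt_comp_sqrt hρ] at h
  -- only countably many of the vectors `√ρ bⱼ` are nonzero
  set t := Function.support fun j => ‖CFC.sqrt ρ (b j)‖ ^ 2 with ht
  have hct : Countable t := (summable_sqrt b hρ).countable_support.to_subtype
  have h' := (hasSum_subtype_iff_of_support_subset (s := t) fun j hj => by
    contrapose! hj
    simp [ht] at hj
    simp [hj]).2 h
  obtain ⟨g, hg⟩ := exists_injective_nat t
  refine ⟨Function.extend g (fun j => CFC.sqrt ρ (b j)) 0, (hg.hasSum_iff fun n hn => ?_).1 ?_⟩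
  · rw [Function.extend_apply' _ _ _ hn]; simp
  · simpa [Function.comp_def, hg.extend_apply] using h'

end Energy

/-! ### The operators `V₁ ρ V₂*` -/

section Sandwich

variable {HA : Type u} [NormedAddCommGroup HA] [InnerProductSpace ℂ HA] [CompleteSpace HA]
  {K : Type*} [NormedAddCommGroup K] [InnerProductSpace ℂ K]
  {G : PositiveOperator HA} {ρ : HA →L[ℂ] HA} {V V₁ V₂ : G.sqrtDomain →ₗ[ℂ] K}

/-- A `√G`-bounded operator becomes bounded after composition with the resolvent of `√G`. -/
theorem exists_comp_resolvent {R : HA →L[ℂ] HA}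
    (hR : ∀ y, ∃ h : R y ∈ G.sqrtDomain, G.sqrt.toLinearPMap ⟨R y, h⟩ = y - R y)
    (hV : IsSqrtBounded G V) :
    ∃ C : HA →L[ℂ] K, ∀ y (φ : G.sqrtDomain), R y = φ → C y = V φ := by
  obtain ⟨a, b, ha, hb, h⟩ := hV
  choose hm hS using hR
  let C : HA →ₗ[ℂ] K := V ∘ₗ R.toLinearMap.codRestrict G.sqrtDomain hm
  refine ⟨C.mkContinuous (a * ‖R‖ + b * ‖1 - R‖) fun y => ?_, ?_⟩
  · have h1 := h ⟨R y, hm y⟩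
    rw [hS] at h1
    have h2 : ‖C y‖ ≤ a * ‖R y‖ + b * ‖y - R y‖ := by
      refine le_of_sq_le_sq (h1.trans ?_) (by positivity)
      have : 0 ≤ (a * ‖R y‖) * (b * ‖y - R y‖) := by positivity
      change a ^ 2 * ‖R y‖ ^ 2 + b ^ 2 * ‖y - R y‖ ^ 2 ≤ _
      nlinarith
    have h3 : ‖y - R y‖ ≤ ‖1 - R‖ * ‖y‖ := (1 - R).le_opNorm y
    calc ‖C y‖ ≤ a * ‖R y‖ + b * ‖y - R y‖ := h2
      _ ≤ a * (‖R‖ * ‖y‖) + b * (‖1 - R‖ * ‖y‖) := by gcongr; exact R.le_opNorm y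
      _ = _ := by ring
  · intro y φ hφ
    exact congrArg V (Subtype.ext hφ)

theorem exists_comp_sqrt (hV : IsSqrtBounded G V) (hρ : ρ ∈ finiteEnergyStates G) :
    ∃ B : HA →L[ℂ] K, ∀ x, B x = V (sqrtVec hρ x) := by
  obtain ⟨R, -, hinj, hR1, hR2⟩ := G.sqrt.exists_resolvent_properties
  obtain ⟨C, hC⟩ := exists_comp_resolvent hR1 hV
  obtain ⟨D, hD⟩ := exists_resolvent_factor hinj hR2 hρ
  exact ⟨C ∘L D, fun x => hC _ _ (DFunLike.congr_fun hD x)⟩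

theorem summable_comp_sqrt {ι : Type u} (b : HilbertBasis ι ℂ HA) (hV : IsSqrtBounded G V)
    (hρ : ρ ∈ finiteEnergyStates G) : Summable fun j => ‖V (sqrtVec hρ (b j))‖ ^ 2 := by
  obtain ⟨c, d, -, -, h⟩ := hV
  exact (((summable_sqrt b hρ).mul_left (c ^ 2)).add
    ((summable_energy b hρ).mul_left (d ^ 2))).of_nonneg_of_le (fun _ => by positivity)
    fun j => h (sqrtVec hρ (b j))

/-- The operator `(V₁√ρ)(V₂√ρ)*` is `V₁ ρ V₂*`. -/
theorem isSandwich_comp_adjoint [CompleteSpace K] (hρ : ρ ∈ finiteEnergyStates G)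
    (hV₁ : IsSqrtBounded G V₁) (hV₂ : IsSqrtBounded G V₂) {B₁ B₂ : HA →L[ℂ] K}
    (hB₁ : ∀ x, B₁ x = V₁ (sqrtVec hρ x)) (hB₂ : ∀ x, B₂ x = V₂ (sqrtVec hρ x)) :
    IsSandwich G V₁ V₂ ρ (B₁ ∘L adjoint B₂) := by
  intro φ hφ
  rw [← sqrt_comp_sqrt hρ] at hφ
  obtain ⟨e, Z, hZ, hZZ⟩ := exists_partialIsometry_of_hasSum (adjoint_sqrt ρ) hφ
  have hvec : ∀ i, (sqrtVec hρ (Z (e i)) : HA) = φ i := hZ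
  refine ⟨fun i => hvec i ▸ (sqrtVec hρ (Z (e i))).2, ?_⟩
  obtain ⟨w, b, -⟩ := exists_hilbertBasis ℂ HA
  have hs₁ : Summable fun k => ‖(B₁ ∘L Z) (e k)‖ ^ 2 :=
    summable_comp b e (by simpa only [hB₁] using summable_comp_sqrt b hV₁ hρ) Z
  have hs₂ : Summable fun k => ‖(B₂ ∘L Z) (e k)‖ ^ 2 :=
    summable_comp b e (by simpa only [hB₂] using summable_comp_sqrt b hV₂ hρ) Z
  have h := hasSum_rankOne e hs₁ hs₂
  -- `B₁` depends on its argument only through `√ρ`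
  have hBZ : B₁ ∘L Z ∘L adjoint Z = B₁ := by
    ext x
    rw [comp_apply, hB₁, hB₁]
    exact congrArg V₁ (Subtype.ext (DFunLike.congr_fun hZZ x))
  rw [adjoint_comp, comp_assoc, ← comp_assoc Z, ← comp_assoc B₁, hBZ] at h
  convert h using 4 with i
  · rw [comp_apply, hB₁]
    exact congrArg V₁ (Subtype.ext (hvec i).symm)
  · rw [comp_apply, hB₂]
    exact congrArg V₂ (Subtype.ext (hvec i).symm)

theorem IsSandwich.unique (hρ : ρ ∈ finiteEnergyStates G) {T T' : K →L[ℂ] K}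
    (h : IsSandwich G V₁ V₂ ρ T) (h' : IsSandwich G V₁ V₂ ρ T') : T = T' := by
  obtain ⟨φ, hφ⟩ := exists_rankOne_decomposition hρ
  obtain ⟨_, h1⟩ := h φ hφ
  obtain ⟨_, h2⟩ := h' φ hφ
  exact h1.unique h2

end Sandwich

/-! ### The maps `ρ ↦ Tr_E V₁ ρ V₂*` -/

section Represents

variable {HA : Type u} [NormedAddCommGroup HA] [InnerProductSpace ℂ HA] [CompleteSpace HA]
  {HB : Type w} [NormedAddCommGroup HB] [InnerProductSpace ℂ HB] [CompleteSpace HB]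
  {HE : Type v} [NormedAddCommGroup HE] [InnerProductSpace ℂ HE] [CompleteSpace HE]
  {G : PositiveOperator HA} {V₁ V₂ : G.sqrtDomain →ₗ[ℂ] HilbertTensor HB HE}

/-- `Ψ(ρ) = Tr_E V₁ ρ V₂*` in terms of matrix elements: `⟨x|Ψ(ρ) y⟩` is the sum over an orthonormal
basis of `⟨(⟨y| ⊗ 1) V₂√ρ bⱼ | (⟨x| ⊗ 1) V₁√ρ bⱼ⟩`. -/
theorem represents_iff {ι : Type u} (b : HilbertBasis ι ℂ HA) (hV₁ : IsSqrtBounded G V₁)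
    (hV₂ : IsSqrtBounded G V₂) (Ψ : finiteEnergySpan G →ₗ[ℂ] traceClass HB) :
    Represents G V₁ V₂ Ψ ↔ ∀ (ρ : HA →L[ℂ] HA) (hρ : ρ ∈ finiteEnergyStates G) (x y : HB),
      HasSum (fun j => ⟪slice y (V₂ (sqrtVec hρ (b j))), slice x (V₁ (sqrtVec hρ (b j)))⟫_ℂ)
        ⟪x, (Ψ ⟨ρ, Submodule.subset_span hρ⟩ : HB →L[ℂ] HB) y⟫_ℂ := by
  refine forall₂_congr fun ρ hρ => ?_
  obtain ⟨B₁, hB₁⟩ := exists_comp_sqrt hV₁ hρ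
  obtain ⟨B₂, hB₂⟩ := exists_comp_sqrt hV₂ hρ
  have hs₁ : Summable fun j => ‖B₁ (b j)‖ ^ 2 := by
    simpa only [hB₁] using summable_comp_sqrt b hV₁ hρ
  have hs₂ : Summable fun j => ‖B₂ (b j)‖ ^ 2 := by
    simpa only [hB₂] using summable_comp_sqrt b hV₂ hρ
  have hS := isSandwich_comp_adjoint hρ hV₁ hV₂ hB₁ hB₂
  have h := isPartialTrace_comp_adjoint_iff b hs₁ hs₂
    (Ψ ⟨ρ, Submodule.subset_span hρ⟩ : HB →L[ℂ] HB)
  simp only [hB₁, hB₂] at h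
  rw [← h]
  constructor
  · rintro ⟨T, -, hT, hp⟩
    rwa [hS.unique hρ hT]
  · exact fun hp => ⟨_, comp_adjoint_mem_traceClass b hs₁ hs₂, hS, hp⟩

theorem eq_of_eq_on_states {F : Type*} [AddCommGroup F] [Module ℂ F]
    {Ψ Ψ' : finiteEnergySpan G →ₗ[ℂ] F}
    (h : ∀ (ρ : HA →L[ℂ] HA) (hρ : ρ ∈ finiteEnergyStates G),
      Ψ ⟨ρ, Submodule.subset_span hρ⟩ = Ψ' ⟨ρ, Submodule.subset_span hρ⟩) : Ψ = Ψ' := by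
  ext1 ⟨σ, hσ⟩
  refine Submodule.span_induction (p := fun σ hσ => Ψ ⟨σ, hσ⟩ = Ψ' ⟨σ, hσ⟩)
    (fun ρ hρ => h ρ hρ) ?_ (fun σ τ hσ hτ h1 h2 => ?_) (fun c σ hσ h1 => ?_) hσ
  · exact (map_zero Ψ).trans (map_zero Ψ').symm
  · exact (map_add Ψ ⟨σ, hσ⟩ ⟨τ, hτ⟩).trans ((congrArg₂ _ h1 h2).trans (map_add Ψ' _ _).symm)
  · exact (map_smul Ψ c ⟨σ, hσ⟩).trans ((congrArg _ h1).trans (map_smul Ψ' _ _).symm)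

theorem Represents.unique (hV₁ : IsSqrtBounded G V₁) (hV₂ : IsSqrtBounded G V₂)
    {Ψ Ψ' : finiteEnergySpan G →ₗ[ℂ] traceClass HB} (h : Represents G V₁ V₂ Ψ)
    (h' : Represents G V₁ V₂ Ψ') : Ψ = Ψ' := by
  obtain ⟨w, b, -⟩ := exists_hilbertBasis ℂ HA
  rw [represents_iff b hV₁ hV₂] at h h'
  refine eq_of_eq_on_states fun ρ hρ => Subtype.ext (ContinuousLinearMap.ext fun y => ?_)
  exact ext_inner_left ℂ fun x => (h ρ hρ x y).unique (h' ρ hρ x y)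

omit [CompleteSpace HB] in
theorem IsPartialTrace.eq_zero {S : HB →L[ℂ] HB}
    (h : IsPartialTrace (0 : HilbertTensor HB HE →L[ℂ] HilbertTensor HB HE) S) : S = 0 := by
  obtain ⟨κ, e, -⟩ := exists_hilbertBasis ℂ HE
  refine ContinuousLinearMap.ext fun y => ext_inner_left ℂ fun x => (h κ e x y).unique ?_
  simp

/-- The map `ρ ↦ Tr_E V₁ ρ V₂*` on states extends to a linear map on their span. Since each state
is `ρ = R τ R` with `R = (1 + √G)⁻¹` injective, `τ` is determined by `ρ`, and the extension is
`R τ R ↦ Tr_E (V₁R) τ (V₂R)*`, which is visibly linear. -/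
theorem exists_represents (hV₁ : IsSqrtBounded G V₁) (hV₂ : IsSqrtBounded G V₂) :
    ∃ Ψ : finiteEnergySpan G →ₗ[ℂ] traceClass HB, Represents G V₁ V₂ Ψ := by
  obtain ⟨w, b, -⟩ := exists_hilbertBasis ℂ HA
  obtain ⟨R, hRa, hinj, hR1, hR2⟩ := G.sqrt.exists_resolvent_properties
  obtain ⟨C₁, hC₁⟩ := exists_comp_resolvent hR1 hV₁
  obtain ⟨C₂, hC₂⟩ := exists_comp_resolvent hR1 hV₂
  -- the graph of the extension
  let Γ : Submodule ℂ ((HA →L[ℂ] HA) × traceClass HB) :=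
    { carrier := {p | ∃ τ : HA →L[ℂ] HA, p.1 = R ∘L τ ∘L R ∧
        IsPartialTrace (C₁ ∘L τ ∘L adjoint C₂) (p.2 : HB →L[ℂ] HB)}
      zero_mem' := ⟨0, by simp, fun κ e x y => by simp⟩
      add_mem' := by
        rintro p q ⟨τ, h1, h2⟩ ⟨τ', h1', h2'⟩
        refine ⟨τ + τ', by simp [h1, h1'], fun κ e x y => ?_⟩
        simpa [inner_add_right] using (h2 κ e x y).add (h2' κ e x y)
      smul_mem' := by
        rintro c p ⟨τ, h1, h2⟩
        refine ⟨c • τ, by simp [h1], fun κ e x y => ?_⟩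
        simpa [inner_smul_right] using (h2 κ e x y).mul_left c }
  have hΓ : ∀ p ∈ Γ, p.1 = 0 → p.2 = 0 := by
    rintro ⟨σ, S⟩ ⟨τ, h1, h2⟩ (h0 : σ = 0)
    have h3 : τ ∘L R = 0 := by
      ext x
      refine hinj ?_
      have := DFunLike.congr_fun (h1.symm.trans h0) x
      simpa using this
    have h4 : τ = 0 := by
      have h5 : adjoint τ = 0 := by
        ext x
        refine hinj ?_
        have h6 := congrArg adjoint h3
        rw [adjoint_comp, hRa, map_zero] at h6
        simpa using DFunLike.congr_fun h6 x
      simpa using congrArg adjoint h5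
    rw [h4] at h2
    exact Subtype.ext (IsPartialTrace.eq_zero (by simpa using h2))
  have hgraph : Γ.toLinearPMap.graph = Γ := Submodule.toLinearPMap_graph_eq Γ hΓ
  have hstate : ∀ ρ (hρ : ρ ∈ finiteEnergyStates G), ∃ S : traceClass HB, (ρ, S) ∈ Γ ∧ ∀ x y,
      HasSum (fun j => ⟪slice y (V₂ (sqrtVec hρ (b j))), slice x (V₁ (sqrtVec hρ (b j)))⟫_ℂ)
        ⟪x, (S : HB →L[ℂ] HB) y⟫_ℂ := by
    intro ρ hρ
    obtain ⟨D, hD⟩ := exists_resolvent_factor hinj hR2 hρ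
    have hB₁ : ∀ x, (C₁ ∘L D) x = V₁ (sqrtVec hρ x) := fun x =>
      hC₁ _ _ (DFunLike.congr_fun hD x)
    have hB₂ : ∀ x, (C₂ ∘L D) x = V₂ (sqrtVec hρ x) := fun x =>
      hC₂ _ _ (DFunLike.congr_fun hD x)
    have hs₁ := summable_comp_sqrt b hV₁ hρ
    have hs₂ := summable_comp_sqrt b hV₂ hρ
    obtain ⟨S, hS, hsum⟩ := exists_partialTrace hs₁ hs₂
    refine ⟨⟨S, hS⟩, ⟨D ∘L adjoint D, ?_, ?_⟩, hsum⟩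
    · have h1 : adjoint D ∘L R = CFC.sqrt ρ := by
        rw [← adjoint_sqrt, ← hD, adjoint_comp, hRa]
      change ρ = _
      rw [comp_assoc, h1, ← comp_assoc, hD, sqrt_comp_sqrt hρ]
    · have h := (isPartialTrace_comp_adjoint_iff b (A := C₁ ∘L D) (B := C₂ ∘L D)
        (by simpa only [hB₁] using hs₁) (by simpa only [hB₂] using hs₂) S).2
        (by simpa only [hB₁, hB₂] using hsum)
      rwa [adjoint_comp, comp_assoc, ← comp_assoc D] at h
  have hle : finiteEnergySpan G ≤ Γ.toLinearPMap.domain := by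
    refine Submodule.span_le.2 fun ρ hρ => ?_
    obtain ⟨S, hS, -⟩ := hstate ρ hρ
    exact LinearPMap.mem_domain_iff.2 ⟨S, by rwa [hgraph]⟩
  refine ⟨Γ.toLinearPMap.toFun ∘ₗ Submodule.inclusion hle,
    (represents_iff b hV₁ hV₂ _).2 fun ρ hρ => ?_⟩
  obtain ⟨S, hS, hsum⟩ := hstate ρ hρ
  rw [← hgraph, LinearPMap.mem_graph_iff] at hS
  obtain ⟨z, hz, hzS⟩ := hS
  have h1 : (Γ.toLinearPMap.toFun ∘ₗ Submodule.inclusion hle)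
      ⟨ρ, Submodule.subset_span hρ⟩ = S := by
    refine Eq.trans ?_ hzS
    exact congrArg Γ.toLinearPMap.toFun (Subtype.ext hz.symm)
  rw [h1]
  exact hsum

end Represents

/-! ### Classes of relatively bounded operators -/

section BoundClasses

variable {HA : Type u} [NormedAddCommGroup HA] [InnerProductSpace ℂ HA] [CompleteSpace HA]

/-- A class of `√G`-bounded operators (into arbitrary Hilbert spaces in a fixed universe) that is
closed under domination in norm by a pair of its members. Both the `√G`-bounded and the
`√G`-infinitesimal operators form such a class. -/
structure IsBoundClass (G : PositiveOperator HA)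
    (P : ∀ (K : Type w) [NormedAddCommGroup K] [InnerProductSpace ℂ K],
      (G.sqrtDomain →ₗ[ℂ] K) → Prop) : Prop where
  isSqrtBounded : ∀ (K : Type w) [NormedAddCommGroup K] [InnerProductSpace ℂ K]
    (V : G.sqrtDomain →ₗ[ℂ] K), P K V → IsSqrtBounded G V
  zero : ∀ (K : Type w) [NormedAddCommGroup K] [InnerProductSpace ℂ K], P K 0
  of_norm_sq_le : ∀ (K K' L : Type w) [NormedAddCommGroup K] [InnerProductSpace ℂ K]
    [NormedAddCommGroup K'] [InnerProductSpace ℂ K'] [NormedAddCommGroup L]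
    [InnerProductSpace ℂ L] (V : G.sqrtDomain →ₗ[ℂ] K) (V' : G.sqrtDomain →ₗ[ℂ] K')
    (W : G.sqrtDomain →ₗ[ℂ] L) (c : ℝ), P K V → P K' V' →
    (∀ φ, ‖W φ‖ ^ 2 ≤ c ^ 2 * (‖V φ‖ ^ 2 + ‖V' φ‖ ^ 2)) → P L W

variable {G : PositiveOperator HA} {K K' L : Type*} [NormedAddCommGroup K] [InnerProductSpace ℂ K]
  [NormedAddCommGroup K'] [InnerProductSpace ℂ K'] [NormedAddCommGroup L] [InnerProductSpace ℂ L]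
  {V : G.sqrtDomain →ₗ[ℂ] K} {V' : G.sqrtDomain →ₗ[ℂ] K'} {W : G.sqrtDomain →ₗ[ℂ] L}

theorem RelBoundWith.of_norm_sq_le {a b a' b' c : ℝ} (hV : RelBoundWith G V a b)
    (hV' : RelBoundWith G V' a' b')
    (h : ∀ φ, ‖W φ‖ ^ 2 ≤ c ^ 2 * (‖V φ‖ ^ 2 + ‖V' φ‖ ^ 2)) :
    RelBoundWith G W (|c| * (|a| + |a'|)) (|c| * (|b| + |b'|)) := by
  intro φ
  have key : ∀ s t : ℝ, c ^ 2 * (s ^ 2 + t ^ 2) ≤ (|c| * (|s| + |t|)) ^ 2 := by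
    intro s t
    rw [mul_pow, sq_abs, add_sq, sq_abs, sq_abs]
    have : 0 ≤ |s| * |t| := by positivity
    gcongr
    linarith
  calc ‖W φ‖ ^ 2 ≤ c ^ 2 * (‖V φ‖ ^ 2 + ‖V' φ‖ ^ 2) := h φ
    _ ≤ c ^ 2 * ((a ^ 2 * ‖(φ : HA)‖ ^ 2 + b ^ 2 * ‖G.sqrt.toLinearPMap φ‖ ^ 2) +
        (a' ^ 2 * ‖(φ : HA)‖ ^ 2 + b' ^ 2 * ‖G.sqrt.toLinearPMap φ‖ ^ 2)) := by
        gcongr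
        · exact hV φ
        · exact hV' φ
    _ = c ^ 2 * (a ^ 2 + a' ^ 2) * ‖(φ : HA)‖ ^ 2 +
        c ^ 2 * (b ^ 2 + b' ^ 2) * ‖G.sqrt.toLinearPMap φ‖ ^ 2 := by ring
    _ ≤ _ := by
        gcongr
        · exact key a a'
        · exact key b b'

theorem isSqrtInfinitesimal_iff :
    IsSqrtInfinitesimal G V ↔ ∀ ε > 0, ∃ a b, 0 ≤ a ∧ 0 ≤ b ∧ b < ε ∧ RelBoundWith G V a b := by
  constructor
  · rintro ⟨⟨a, b, ha, hb, h⟩, h0⟩ ε hε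
    obtain ⟨b', ⟨hb', a', ha', h'⟩, hlt⟩ := exists_lt_of_csInf_lt
      (s := {b : ℝ | 0 ≤ b ∧ ∃ a : ℝ, 0 ≤ a ∧ RelBoundWith G V a b}) ⟨b, hb, a, ha, h⟩
      (b := ε) (by rw [← sqrtBound, h0]; exact hε)
    exact ⟨a', b', ha', hb', hlt, h'⟩
  · intro h
    obtain ⟨a, b, ha, hb, -, h1⟩ := h 1 one_pos
    refine ⟨⟨a, b, ha, hb, h1⟩, le_antisymm (le_of_forall_pos_lt_add fun ε hε => ?_)
      (Real.sInf_nonneg fun b hb => hb.1)⟩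
    obtain ⟨a', b', ha', hb', hlt, h'⟩ := h ε hε
    rw [zero_add]
    exact (csInf_le (s := {b : ℝ | 0 ≤ b ∧ ∃ a : ℝ, 0 ≤ a ∧ RelBoundWith G V a b})
      ⟨0, fun b hb => hb.1⟩ ⟨hb', a', ha', h'⟩).trans_lt hlt

theorem isBoundClass_isSqrtBounded (G : PositiveOperator HA) :
    IsBoundClass.{u, w} G fun _ _ _ V => IsSqrtBounded G V where
  isSqrtBounded _ _ _ _ h := h
  zero _ _ _ := ⟨0, 0, le_rfl, le_rfl, fun φ => by simp⟩
  of_norm_sq_le := by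
    rintro K K' L _ _ _ _ _ _ V V' W c ⟨a, b, -, -, h⟩ ⟨a', b', -, -, h'⟩ hc
    exact ⟨_, _, by positivity, by positivity, h.of_norm_sq_le h' hc⟩

theorem isBoundClass_isSqrtInfinitesimal (G : PositiveOperator HA) :
    IsBoundClass.{u, w} G fun _ _ _ V => IsSqrtInfinitesimal G V where
  isSqrtBounded _ _ _ _ h := h.1
  zero _ _ _ := isSqrtInfinitesimal_iff.2 fun ε hε =>
    ⟨0, 0, le_rfl, le_rfl, hε, fun φ => by simp⟩
  of_norm_sq_le := by
    intro K K' L _ _ _ _ _ _ V V' W c h h' hc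
    rw [isSqrtInfinitesimal_iff] at h h' ⊢
    intro ε hε
    have hδ : 0 < ε / (2 * (|c| + 1)) := by positivity
    obtain ⟨a, b, -, hb, hbε, h⟩ := h _ hδ
    obtain ⟨a', b', -, hb', hbε', h'⟩ := h' _ hδ
    refine ⟨_, _, by positivity, by positivity, ?_, h.of_norm_sq_le h' hc⟩
    rw [abs_of_nonneg hb, abs_of_nonneg hb']
    rw [lt_div_iff₀ (by positivity)] at hbε hbε'
    nlinarith [abs_nonneg c]

end BoundClasses

/-! ### Hilbert space direct sums -/

section DirectSum

variable (E : Type*) [NormedAddCommGroup E] [InnerProductSpace ℂ E]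
  (F : Type*) [NormedAddCommGroup F] [InnerProductSpace ℂ F]

/-- The inclusion of the first summand of a Hilbert space direct sum. -/
noncomputable def inlIsometry : E →ₗᵢ[ℂ] WithLp 2 (E × F) where
  toFun x := WithLp.toLp 2 (x, 0)
  map_add' x y := by rw [← WithLp.toLp_add]; simp
  map_smul' c x := by rw [RingHom.id_apply, ← WithLp.toLp_smul]; simp
  norm_map' x := WithLp.norm_toLp_fst 2 E F x

/-- The inclusion of the second summand of a Hilbert space direct sum. -/
noncomputable def inrIsometry : F →ₗᵢ[ℂ] WithLp 2 (E × F) where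
  toFun x := WithLp.toLp 2 (0, x)
  map_add' x y := by rw [← WithLp.toLp_add]; simp
  map_smul' c x := by rw [RingHom.id_apply, ← WithLp.toLp_smul]; simp
  norm_map' x := WithLp.norm_toLp_snd 2 E F x

variable {E F}

theorem inner_inl_add_inr (x x' : E) (y y' : F) :
    ⟪inlIsometry E F x + inrIsometry E F y, inlIsometry E F x' + inrIsometry E F y'⟫_ℂ =
      ⟪x, x'⟫_ℂ + ⟪y, y'⟫_ℂ := by
  simp [inlIsometry, inrIsometry, WithLp.prod_inner_apply]

end DirectSum

/-! ### Linear combinations and polarization -/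

section Span

variable {HA : Type u} [NormedAddCommGroup HA] [InnerProductSpace ℂ HA] [CompleteSpace HA]
  {HB : Type w} [NormedAddCommGroup HB] [InnerProductSpace ℂ HB] [CompleteSpace HB]
  {G : PositiveOperator HA}
  {P : ∀ (K : Type (max w v)) [NormedAddCommGroup K] [InnerProductSpace ℂ K],
    (G.sqrtDomain →ₗ[ℂ] K) → Prop}

/-- A sum of maps `Tr_E V₁ ρ V₂*` is again of this form, over the direct sum of the environments:
the cross terms vanish under the partial trace since the summands are orthogonal. -/
theorem Represents.directSum (hP : IsBoundClass.{u, max w v} G P)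
    {HE : Type v} [NormedAddCommGroup HE] [InnerProductSpace ℂ HE] [CompleteSpace HE]
    {HF : Type v} [NormedAddCommGroup HF] [InnerProductSpace ℂ HF] [CompleteSpace HF]
    {V₁ V₂ : G.sqrtDomain →ₗ[ℂ] HilbertTensor HB HE}
    {W₁ W₂ : G.sqrtDomain →ₗ[ℂ] HilbertTensor HB HF}
    (hV₁ : P _ V₁) (hV₂ : P _ V₂) (hW₁ : P _ W₁) (hW₂ : P _ W₂)
    {Ψ Θ : finiteEnergySpan G →ₗ[ℂ] traceClass HB}
    (hΨ : Represents G V₁ V₂ Ψ) (hΘ : Represents G W₁ W₂ Θ) :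
    ∃ U₁ U₂ : G.sqrtDomain →ₗ[ℂ] HilbertTensor HB (WithLp 2 (HE × HF)),
      P _ U₁ ∧ P _ U₂ ∧ Represents G U₁ U₂ (Ψ + Θ) := by
  obtain ⟨I, hI⟩ := exists_lTensor (HB := HB) (inlIsometry HE HF)
  obtain ⟨J, hJ⟩ := exists_lTensor (HB := HB) (inrIsometry HE HF)
  have hPU : ∀ (V : G.sqrtDomain →ₗ[ℂ] HilbertTensor HB HE)
      (W : G.sqrtDomain →ₗ[ℂ] HilbertTensor HB HF), P _ V → P _ W →
      P _ (I.toLinearMap ∘ₗ V + J.toLinearMap ∘ₗ W) := by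
    intro V W hV hW
    refine hP.of_norm_sq_le _ _ _ V W _ (‖I‖ + ‖J‖) hV hW fun φ => ?_
    have h1 : ‖I (V φ) + J (W φ)‖ ≤ ‖I‖ * ‖V φ‖ + ‖J‖ * ‖W φ‖ :=
      (norm_add_le _ _).trans (add_le_add (I.le_opNorm _) (J.le_opNorm _))
    -- Cauchy–Schwarz, with `‖I‖² + ‖J‖² ≤ (‖I‖ + ‖J‖)²`
    calc ‖I (V φ) + J (W φ)‖ ^ 2 ≤ (‖I‖ * ‖V φ‖ + ‖J‖ * ‖W φ‖) ^ 2 := by gcongr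
      _ ≤ (‖I‖ ^ 2 + ‖J‖ ^ 2) * (‖V φ‖ ^ 2 + ‖W φ‖ ^ 2) := by
          nlinarith [sq_nonneg (‖I‖ * ‖W φ‖ - ‖J‖ * ‖V φ‖)]
      _ ≤ (‖I‖ + ‖J‖) ^ 2 * (‖V φ‖ ^ 2 + ‖W φ‖ ^ 2) := by
          gcongr
          nlinarith [norm_nonneg I, norm_nonneg J, mul_nonneg (norm_nonneg I) (norm_nonneg J)]
  refine ⟨_, _, hPU V₁ W₁ hV₁ hW₁, hPU V₂ W₂ hV₂ hW₂, ?_⟩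
  obtain ⟨w, b, -⟩ := exists_hilbertBasis ℂ HA
  rw [represents_iff b (hP.isSqrtBounded _ _ hV₁) (hP.isSqrtBounded _ _ hV₂)] at hΨ
  rw [represents_iff b (hP.isSqrtBounded _ _ hW₁) (hP.isSqrtBounded _ _ hW₂)] at hΘ
  rw [represents_iff b (hP.isSqrtBounded _ _ (hPU V₁ W₁ hV₁ hW₁))
    (hP.isSqrtBounded _ _ (hPU V₂ W₂ hV₂ hW₂))]
  intro ρ hρ x y
  have h := (hΨ ρ hρ x y).add (hΘ ρ hρ x y)
  simp only [LinearMap.add_apply, LinearMap.comp_apply, coe_coe, map_add, hI, hJ,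
    inner_inl_add_inr]
  simpa [inner_add_right] using h

theorem Represents.smul_left (hP : IsBoundClass.{u, max w v} G P)
    {HE : Type v} [NormedAddCommGroup HE] [InnerProductSpace ℂ HE] [CompleteSpace HE]
    {V₁ V₂ : G.sqrtDomain →ₗ[ℂ] HilbertTensor HB HE} (hV₁ : P _ V₁) (hV₂ : P _ V₂) (c : ℂ)
    {Ψ : finiteEnergySpan G →ₗ[ℂ] traceClass HB} (hΨ : Represents G V₁ V₂ Ψ) :
    P _ (c • V₁) ∧ Represents G (c • V₁) V₂ (c • Ψ) := by
  have hc : P _ (c • V₁) := hP.of_norm_sq_le _ _ _ V₁ V₁ _ ‖c‖ hV₁ hV₁ fun φ => by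
    rw [LinearMap.smul_apply, norm_smul, mul_pow]
    gcongr
    exact le_add_of_nonneg_right (by positivity)
  refine ⟨hc, ?_⟩
  obtain ⟨w, b, -⟩ := exists_hilbertBasis ℂ HA
  rw [represents_iff b (hP.isSqrtBounded _ _ hV₁) (hP.isSqrtBounded _ _ hV₂)] at hΨ
  rw [represents_iff b (hP.isSqrtBounded _ _ hc) (hP.isSqrtBounded _ _ hV₂)]
  intro ρ hρ x y
  simpa [inner_smul_right] using (hΨ ρ hρ x y).mul_left c

theorem inner_polarization {E : Type*} [NormedAddCommGroup E] [InnerProductSpace ℂ E]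
    (a b a' b' : E) :
    ⟪b, a'⟫_ℂ = 4⁻¹ * (⟪a + (1 : ℂ) • b, a' + (1 : ℂ) • b'⟫_ℂ +
      (-1) * ⟪a + (-1 : ℂ) • b, a' + (-1 : ℂ) • b'⟫_ℂ +
      Complex.I * ⟪a + Complex.I • b, a' + Complex.I • b'⟫_ℂ +
      (-Complex.I) * ⟪a + (-Complex.I) • b, a' + (-Complex.I) • b'⟫_ℂ) := by
  simp only [inner_add_left, inner_add_right, inner_smul_left, inner_smul_right, map_neg, map_one,
    Complex.conj_I]
  linear_combination (2⁻¹ * ⟪b, a'⟫_ℂ - 2⁻¹ * ⟪a, b'⟫_ℂ) * Complex.I_sq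

/-- Polarization: `4 V₁ ρ V₂* = ∑ c (V₁ + c V₂) ρ (V₁ + c V₂)*` over the fourth roots of unity
`c`. -/
theorem Represents.polarization (hP : IsBoundClass.{u, max w v} G P)
    {HE : Type v} [NormedAddCommGroup HE] [InnerProductSpace ℂ HE] [CompleteSpace HE]
    {V₁ V₂ : G.sqrtDomain →ₗ[ℂ] HilbertTensor HB HE} (hV₁ : P _ V₁) (hV₂ : P _ V₂)
    {Ψ : finiteEnergySpan G →ₗ[ℂ] traceClass HB} (hΨ : Represents G V₁ V₂ Ψ) :
    (∀ c : ℂ, P _ (V₁ + c • V₂)) ∧ ∃ Φ : ℂ → finiteEnergySpan G →ₗ[ℂ] traceClass HB,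
      (∀ c, Represents G (V₁ + c • V₂) (V₁ + c • V₂) (Φ c)) ∧
      Ψ = (4⁻¹ : ℂ) • (Φ 1 + (-1 : ℂ) • Φ (-1) + Complex.I • Φ Complex.I +
        (-Complex.I) • Φ (-Complex.I)) := by
  have hc : ∀ c : ℂ, P _ (V₁ + c • V₂) := fun c => by
    refine hP.of_norm_sq_le _ _ _ V₁ V₂ _ (1 + ‖c‖) hV₁ hV₂ fun φ => ?_
    have h1 : ‖V₁ φ + c • V₂ φ‖ ≤ ‖V₁ φ‖ + ‖c‖ * ‖V₂ φ‖ :=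
      (norm_add_le _ _).trans_eq (by rw [norm_smul])
    calc ‖V₁ φ + c • V₂ φ‖ ^ 2 ≤ (‖V₁ φ‖ + ‖c‖ * ‖V₂ φ‖) ^ 2 := by gcongr
      _ ≤ (1 ^ 2 + ‖c‖ ^ 2) * (‖V₁ φ‖ ^ 2 + ‖V₂ φ‖ ^ 2) := by
          nlinarith [sq_nonneg (‖V₂ φ‖ - ‖c‖ * ‖V₁ φ‖)]
      _ ≤ (1 + ‖c‖) ^ 2 * (‖V₁ φ‖ ^ 2 + ‖V₂ φ‖ ^ 2) := by
          gcongr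
          nlinarith [norm_nonneg c]
  have hb₁ := hP.isSqrtBounded _ _ hV₁
  have hb₂ := hP.isSqrtBounded _ _ hV₂
  have hbc := fun c => hP.isSqrtBounded _ _ (hc c)
  choose Φ hΦ using fun c => exists_represents (hbc c) (hbc c)
  refine ⟨hc, Φ, hΦ, hΨ.unique hb₁ hb₂ ?_⟩
  obtain ⟨w, b, -⟩ := exists_hilbertBasis ℂ HA
  have h := fun c => (represents_iff b (hbc c) (hbc c) (Φ c)).1 (hΦ c)
  rw [represents_iff b hb₁ hb₂]
  intro ρ hρ x y
  have h1 := (((h 1 ρ hρ x y).add ((h (-1) ρ hρ x y).mul_left (-1))).add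
    ((h Complex.I ρ hρ x y).mul_left Complex.I)).add
    ((h (-Complex.I) ρ hρ x y).mul_left (-Complex.I)) |>.mul_left 4⁻¹
  simp only [LinearMap.add_apply, LinearMap.smul_apply, map_add, map_smul,
    ← inner_polarization] at h1
  simpa [inner_smul_right, inner_add_right, mul_add] using h1

theorem mem_span_iff_exists_represents (hP : IsBoundClass.{u, max w v} G P)
    (Ψ : finiteEnergySpan G →ₗ[ℂ] traceClass HB) :
    Ψ ∈ Submodule.span ℂ {Φ : finiteEnergySpan G →ₗ[ℂ] traceClass HB |
      ∃ (HE : Type v) (_ : NormedAddCommGroup HE) (_ : InnerProductSpace ℂ HE)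
        (_ : CompleteSpace HE) (_ : TopologicalSpace.SeparableSpace HE)
        (V : G.sqrtDomain →ₗ[ℂ] HilbertTensor HB HE), P _ V ∧ Represents G V V Φ} ↔
      ∃ (HE : Type v) (_ : NormedAddCommGroup HE) (_ : InnerProductSpace ℂ HE)
        (_ : CompleteSpace HE) (_ : TopologicalSpace.SeparableSpace HE)
        (V₁ V₂ : G.sqrtDomain →ₗ[ℂ] HilbertTensor HB HE),
        P _ V₁ ∧ P _ V₂ ∧ Represents G V₁ V₂ Ψ := by
  constructor
  · intro h
    induction h using Submodule.span_induction with
    | mem Φ h =>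
      obtain ⟨HE, i1, i2, i3, i4, V, hV, h⟩ := h
      exact ⟨HE, i1, i2, i3, i4, V, V, hV, hV, h⟩
    | zero =>
      refine ⟨EuclideanSpace ℂ PEmpty.{v + 1}, inferInstance, inferInstance, inferInstance,
        inferInstance, 0, 0, hP.zero _, hP.zero _, ?_⟩
      obtain ⟨w, b, -⟩ := exists_hilbertBasis ℂ HA
      refine (represents_iff b (hP.isSqrtBounded _ _ (hP.zero _))
        (hP.isSqrtBounded _ _ (hP.zero _)) _).2 fun ρ hρ x y => ?_
      simp
    | add Ψ Θ _ _ h1 h2 =>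
      obtain ⟨HE, _, _, _, _, V₁, V₂, hV₁, hV₂, h⟩ := h1
      obtain ⟨HF, _, _, _, _, W₁, W₂, hW₁, hW₂, h'⟩ := h2
      have : SecondCountableTopology HE := UniformSpace.secondCountable_of_separable HE
      have : SecondCountableTopology HF := UniformSpace.secondCountable_of_separable HF
      obtain ⟨U₁, U₂, hU₁, hU₂, hU⟩ := h.directSum hP hV₁ hV₂ hW₁ hW₂ h'
      have hsep : TopologicalSpace.SeparableSpace (WithLp 2 (HE × HF)) := inferInstance
      exact ⟨WithLp 2 (HE × HF), _, _, inferInstance, hsep,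
        U₁, U₂, hU₁, hU₂, hU⟩
    | smul c Ψ _ h1 =>
      obtain ⟨HE, i1, i2, i3, i4, V₁, V₂, hV₁, hV₂, h⟩ := h1
      obtain ⟨h2, h3⟩ := h.smul_left hP hV₁ hV₂ c
      exact ⟨HE, i1, i2, i3, i4, c • V₁, V₂, h2, hV₂, h3⟩
  · rintro ⟨HE, i1, i2, i3, i4, V₁, V₂, hV₁, hV₂, h⟩
    obtain ⟨hc, Φ, hΦ, rfl⟩ := h.polarization hP hV₁ hV₂
    have key : ∀ N : Submodule ℂ (finiteEnergySpan G →ₗ[ℂ] traceClass HB), (∀ c, Φ c ∈ N) →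
        (4⁻¹ : ℂ) • (Φ 1 + (-1 : ℂ) • Φ (-1) + Complex.I • Φ Complex.I +
          (-Complex.I) • Φ (-Complex.I)) ∈ N :=
      fun N hN => N.smul_mem _ (N.add_mem (N.add_mem (N.add_mem (hN _) (N.smul_mem _ (hN _)))
        (N.smul_mem _ (hN _))) (N.smul_mem _ (hN _)))
    exact key _ fun c => Submodule.subset_span ⟨HE, i1, i2, i3, i4, V₁ + c • V₂, hc c, hΦ c⟩

end Span

theorem proposition2
    {HA : Type u} [NormedAddCommGroup HA] [InnerProductSpace ℂ HA] [CompleteSpace HA]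
    [TopologicalSpace.SeparableSpace HA]
    {HB : Type w} [NormedAddCommGroup HB] [InnerProductSpace ℂ HB] [CompleteSpace HB]
    [TopologicalSpace.SeparableSpace HB]
    (G : PositiveOperator HA) (Ψ : finiteEnergySpan G →ₗ[ℂ] traceClass HB) :
    (Ψ ∈ Submodule.span ℂ (coneFG0.{u, v, w} G HB) ↔
      ∃ (HE : Type v) (_ : NormedAddCommGroup HE) (_ : InnerProductSpace ℂ HE)
        (_ : CompleteSpace HE) (_ : TopologicalSpace.SeparableSpace HE)
        (V₁ V₂ : G.sqrtDomain →ₗ[ℂ] HilbertTensor HB HE),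
        IsSqrtInfinitesimal G V₁ ∧ IsSqrtInfinitesimal G V₂ ∧ Represents G V₁ V₂ Ψ) ∧
    (Ψ ∈ Submodule.span ℂ (coneFG.{u, v, w} G HB) ↔
      ∃ (HE : Type v) (_ : NormedAddCommGroup HE) (_ : InnerProductSpace ℂ HE)
        (_ : CompleteSpace HE) (_ : TopologicalSpace.SeparableSpace HE)
        (V₁ V₂ : G.sqrtDomain →ₗ[ℂ] HilbertTensor HB HE),
        IsSqrtBounded G V₁ ∧ IsSqrtBounded G V₂ ∧ Represents G V₁ V₂ Ψ) := by
  -- `coneFG0` and `coneFG` unfold to the sets of the general statement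
  exact ⟨mem_span_iff_exists_represents (isBoundClass_isSqrtInfinitesimal G) Ψ,
    mem_span_iff_exists_represents (isBoundClass_isSqrtBounded G) Ψ⟩
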